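/- Let $\alpha>0$ and $\beta\ge 0$, and consider on $\mathbb{R}^2$ the system \[ \dot\lambda = 2\beta(m+\tanh\lambda)-\alpha\lambda,\qquad \dot m=-2(m+\tanh\lambda). \] (i) If $\beta\le \frac{\alpha}{2}+1$, the origin is a global attractor: it is a fixed point, it is Lyapunov stable, and from every initial point of $\mathbb{R}^2$ the solution exists for all $t\ge 0$ and converges to the origin as $t\to\infty$. (ii) If $\beta>\frac{\alpha}{2}+1$, the system has exactly one periodic orbit $\Gamma$ (the image of a nonconstant periodic solution), and $\Gamma$ attracts all trajectories except the fixed point: from every initial point other than the origin the solution exists for all $t\ge 0$ and its distance to $\Gamma$ tends to $0$ as $t\to\infty$. -/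

import Mathlib

open Filter Topology Set

/-- The planar vector field on pairs `(lam, m)`:
`lam' = 2 β (m + tanh lam) - α lam`, `m' = -2 (m + tanh lam)`. -/
noncomputable def spinField (α β : ℝ) (p : ℝ × ℝ) : ℝ × ℝ :=
  (2 * β * (p.2 + Real.tanh p.1) - α * p.1, -2 * (p.2 + Real.tanh p.1))

/-- `x` solves the autonomous equation `x' = v x` on `[0, ∞)`
(with the one-sided derivative at time `0`). -/
def IsForwardTrajectory (v : ℝ × ℝ → ℝ × ℝ) (x : ℝ → ℝ × ℝ) : Prop :=
  IsIntegralCurveOn x (fun _ => v) (Ici 0)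

/-- `A` attracts the trajectory of `v` issued from `p`: there is a solution on `[0, ∞)` starting
at `p`, and along any such solution the distance to `A` tends to `0`. -/
def AttractsFrom (v : ℝ × ℝ → ℝ × ℝ) (A : Set (ℝ × ℝ)) (p : ℝ × ℝ) : Prop :=
  (∃ x, IsForwardTrajectory v x ∧ x 0 = p) ∧
    ∀ x, IsForwardTrajectory v x → x 0 = p →
      Tendsto (fun t => Metric.infDist (x t) A) atTop (𝓝 0)

/-- Stability of the point `q` in the sense of Lyapunov. -/
def IsLyapunovStable (v : ℝ × ℝ → ℝ × ℝ) (q : ℝ × ℝ) : Prop :=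
  ∀ ε > 0, ∃ δ > 0, ∀ x, IsForwardTrajectory v x → dist (x 0) q < δ →
    ∀ t, 0 ≤ t → dist (x t) q < ε

/-- The point `q` is a global attractor (a globally asymptotically stable equilibrium):
it is a fixed point, it is Lyapunov stable, and it attracts every trajectory. -/
def IsGlobalAttractor (v : ℝ × ℝ → ℝ × ℝ) (q : ℝ × ℝ) : Prop :=
  v q = 0 ∧ IsLyapunovStable v q ∧ ∀ p, AttractsFrom v {q} p

/-- `Γ` is a periodic orbit of `v`: the image of a nonconstant periodic solution. -/
def IsPeriodicOrbit (v : ℝ × ℝ → ℝ × ℝ) (Γ : Set (ℝ × ℝ)) : Prop :=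
  ∃ x : ℝ → ℝ × ℝ, IsIntegralCurve x (fun _ => v) ∧ (∃ T > 0, Function.Periodic x T) ∧
    (∃ t, x t ≠ x 0) ∧ Γ = range x

/-! With `y = lam + β m` the system takes Liénard form `lam' = 2 y - F(lam)`, `y' = -α lam`, where
`F` is `lienardDamping`. The energy `α/2 lam² + y²` has derivative `-α lam F(lam)`. If `β ≤ α/2 +
1`, then `tanh x < x` for `x > 0` gives `x F(x) > 0` off zero when `β > 0`, and LaSalle's principle
gives global attraction. The coordinate `y` degenerates at `β = 0`, where another quadratic Lyapunov
function serves.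

If `β > α/2 + 1`, follow an orbit from `(lam, y) = (0, a)` through `lam > 0` to its return at `(0,
-P a)`. The field is odd, so the next half turn is governed by the same map `P`. It is increasing
because orbits do not cross (`right_lt_right`); it satisfies `P a > a` for small `a`, since energy
grows where `F < 0` (`left_lt_right`); and `P a < β` always, because `m > -1` persists (`right_lt`).
The decisive property is `P (k a) < k P a` for `k > 1` (`lt_mul_right`): concavity of `tanh` makes
`F(x)/x` increasing, so dilating an arc yields a strict barrier.

These properties give `P` one fixed point `r`, attracting every `a > 0` (`exists_tendsto_iterate`).
Its orbit is the cycle. Convergence of the crossings, with return times bounded near `r` and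
Grönwall's estimate, gives convergence in distance to the cycle; this attraction also forces
uniqueness. -/

/-! ### Calculus of `tanh`. -/

theorem hasDerivAt_tanh (x : ℝ) : HasDerivAt Real.tanh (1 - Real.tanh x ^ 2) x := by
  have h : Real.tanh = fun x => Real.sinh x / Real.cosh x := funext Real.tanh_eq_sinh_div_cosh
  have hc := (Real.cosh_pos x).ne'
  rw [h]
  refine ((Real.hasDerivAt_sinh x).div (Real.hasDerivAt_cosh x) hc).congr_deriv ?_
  field_simp

theorem continuous_tanh : Continuous Real.tanh :=
  continuous_iff_continuousAt.2 fun x => (hasDerivAt_tanh x).continuousAt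

theorem contDiff_tanh {n : WithTop ℕ∞} : ContDiff ℝ n Real.tanh := by
  have h : Real.tanh = fun x => Real.sinh x / Real.cosh x := funext Real.tanh_eq_sinh_div_cosh
  rw [h]
  exact Real.contDiff_sinh.div Real.contDiff_cosh fun x => (Real.cosh_pos x).ne'

theorem lipschitzWith_tanh : LipschitzWith 1 Real.tanh := by
  refine lipschitzWith_of_nnnorm_deriv_le (fun x => (hasDerivAt_tanh x).differentiableAt) fun x => ?_
  rw [(hasDerivAt_tanh x).deriv, ← NNReal.coe_le_coe, coe_nnnorm, Real.norm_eq_abs, abs_le]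
  have := Real.tanh_sq_lt_one x
  constructor <;> simp <;> nlinarith [sq_nonneg (Real.tanh x)]

theorem strictMono_tanh : StrictMono Real.tanh := by
  refine strictMono_of_deriv_pos fun x => ?_
  rw [(hasDerivAt_tanh x).deriv]
  linarith [Real.tanh_sq_lt_one x]

theorem tanh_pos {x : ℝ} (hx : 0 < x) : 0 < Real.tanh x := by
  simpa using strictMono_tanh hx

theorem strictConcaveOn_tanh : StrictConcaveOn ℝ (Ici 0) Real.tanh := by
  refine StrictAntiOn.strictConcaveOn_of_deriv (convex_Ici 0) continuous_tanh.continuousOn ?_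
  intro x hx y hy hxy
  rw [interior_Ici] at hx hy
  rw [(hasDerivAt_tanh x).deriv, (hasDerivAt_tanh y).deriv]
  nlinarith [tanh_pos hx, strictMono_tanh hxy]

/-- The graph of `tanh` on the positive axis lies below its dilations by `k > 1`. -/
theorem tanh_lt_mul_tanh_div {x k : ℝ} (hx : 0 < x) (hk : 1 < k) :
    Real.tanh x < k * Real.tanh (x / k) := by
  have hk0 : 0 < k := by linarith
  have h := strictConcaveOn_tanh.2 (by simp : (0 : ℝ) ∈ Ici 0) hx.le hx.ne
    (by rw [sub_pos, div_lt_one hk0]; exact hk : 0 < 1 - 1 / k)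
    (by positivity : 0 < 1 / k) (by ring)
  simp only [smul_eq_mul, mul_zero, Real.tanh_zero, zero_add] at h
  rw [one_div_mul_eq_div, one_div_mul_eq_div, div_lt_iff₀ hk0] at h
  linarith

theorem tanh_lt_self {x : ℝ} (hx : 0 < x) : Real.tanh x < x := by
  have h : StrictMonoOn (fun x => x - Real.tanh x) (Ici 0) := by
    refine strictMonoOn_of_deriv_pos (convex_Ici 0)
      (continuous_id.sub continuous_tanh).continuousOn fun y hy => ?_
    rw [interior_Ici] at hy
    rw [((hasDerivAt_id' y).fun_sub (hasDerivAt_tanh y)).deriv]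
    have := tanh_pos hy
    nlinarith
  have := h (by simp) hx.le hx
  simp at this
  exact this

/-! ### Global flows of Lipschitz fields. -/

section GlobalFlow

variable {E : Type*} [NormedAddCommGroup E] [NormedSpace ℝ E] {v : E → E} {K : NNReal}

/-- A globally Lipschitz `C¹` vector field is complete. -/
theorem exists_isIntegralCurve_of_lipschitzWith [CompleteSpace E] (hK : LipschitzWith K v)
    (hv : ContDiff ℝ 1 v) (p : E) : ∃ γ : ℝ → E, γ 0 = p ∧ IsIntegralCurve γ (fun _ => v) := by
  have hε : (0 : ℝ) < 1 / (2 * K + 2) := by positivity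
  -- The lifespan must not depend on `q`. On the ball of radius `‖v q‖ + 1` the speed is at most `‖v
  -- q‖ + K (‖v q‖ + 1)`, so this `ε` keeps the curve inside; uniform local existence then extends
  -- to all times.
  set ε : ℝ := 1 / (2 * K + 2) with hεdef
  have local_curve : ∀ q : E, ∃ γ : ℝ → E, γ 0 = q ∧
      ∀ t ∈ Icc (-ε) ε, HasDerivWithinAt γ (v (γ t)) (Icc (-ε) ε) t := by
    intro q
    have hPL : IsPicardLindelof (fun _ => v) (tmin := -ε) (tmax := ε) ⟨0, by simp [hε.le]⟩ q
        (‖v q‖₊ + 1) 0 (‖v q‖₊ + K * (‖v q‖₊ + 1)) K := by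
      refine IsPicardLindelof.of_time_independent (fun x hx => ?_) hK.lipschitzOnWith ?_
      · have h1 : ‖v x‖ ≤ ‖v q‖ + ‖v x - v q‖ := by
          simpa using norm_add_le (v q) (v x - v q)
        have h2 := hK.dist_le_mul x q
        rw [dist_eq_norm] at h2
        have h3 : (K : ℝ) * dist x q ≤ K * ((‖v q‖₊ + 1 : NNReal) : ℝ) := by
          gcongr
          exact hx
        push_cast at h3 ⊢
        linarith
      · simp only [sub_zero, sub_neg_eq_add, zero_add, max_self, NNReal.coe_zero]
        push_cast
        rw [hεdef, mul_one_div, div_le_iff₀ (by positivity)]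
        have h1 := norm_nonneg (v q)
        have h2 : (0 : ℝ) ≤ K := K.2
        nlinarith [mul_nonneg h1 h2]
    exact hPL.exists_eq_forall_mem_Icc_hasDerivWithinAt₀
  have hmf : ∀ q : E, ∃ γ : ℝ → E, γ 0 = q ∧
      IsMIntegralCurveOn (I := modelWithCornersSelf ℝ E) γ v (Ioo (-ε) ε) := by
    intro q
    obtain ⟨γ, h0, hγ⟩ := local_curve q
    refine ⟨γ, h0, fun t ht => ?_⟩
    have h := ((hγ t (Ioo_subset_Icc_self ht)).mono Ioo_subset_Icc_self).hasFDerivWithinAt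
    exact h.hasMFDerivWithinAt
  obtain ⟨γ, h0, hγ⟩ := exists_isMIntegralCurve_of_isMIntegralCurveOn
    (I := modelWithCornersSelf ℝ E) (v := v) (contMDiff_vectorSpace_iff_contDiff.2 hv) hε hmf p
  refine ⟨γ, h0, fun t => ?_⟩
  have h : HasFDerivAt γ (ContinuousLinearMap.smulRight (1 : ℝ →L[ℝ] ℝ) (v (γ t))) t :=
    (hγ t).hasFDerivAt
  exact hasDerivAt_iff_hasFDerivAt.2 h

theorem IsIntegralCurve.eq_of_lipschitzWith (hK : LipschitzWith K v) {f g : ℝ → E}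
    (hf : IsIntegralCurve f (fun _ => v)) (hg : IsIntegralCurve g (fun _ => v)) {t₀ : ℝ}
    (h : f t₀ = g t₀) : f = g :=
  ODE_solution_unique_univ (v := fun _ => v) (s := fun _ => univ) (fun _ => hK.lipschitzOnWith)
    (fun t => ⟨hf t, trivial⟩) (fun t => ⟨hg t, trivial⟩) h

theorem IsIntegralCurveOn.eqOn_Ici_of_lipschitzWith (hK : LipschitzWith K v) {f g : ℝ → E}
    (hf : IsIntegralCurveOn f (fun _ => v) (Ici 0)) (hg : IsIntegralCurveOn g (fun _ => v) (Ici 0))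
    (h : f 0 = g 0) : EqOn f g (Ici 0) := by
  intro t ht
  refine ODE_solution_unique_of_mem_Icc_right (v := fun _ => v) (s := fun _ => univ) (a := 0)
    (b := t) (fun _ _ => hK.lipschitzOnWith) (hf.continuousOn.mono Icc_subset_Ici_self)
    (fun s hs => (hf s hs.1).mono (Ici_subset_Ici.2 hs.1)) (fun _ _ => trivial)
    (hg.continuousOn.mono Icc_subset_Ici_self)
    (fun s hs => (hg s hs.1).mono (Ici_subset_Ici.2 hs.1)) (fun _ _ => trivial) h ⟨ht, le_rfl⟩

end GlobalFlow

/-! ### The flow and its odd symmetry. -/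

theorem contDiff_spinField (α β : ℝ) : ContDiff ℝ 1 (spinField α β) := by
  have h : ContDiff ℝ 1 fun p : ℝ × ℝ => Real.tanh p.1 := contDiff_tanh.comp contDiff_fst
  unfold spinField
  fun_prop

theorem exists_lipschitzWith_spinField (α β : ℝ) : ∃ K, LipschitzWith K (spinField α β) := by
  have h : LipschitzWith (1 * 1) fun p : ℝ × ℝ => Real.tanh p.1 :=
    lipschitzWith_tanh.comp LipschitzWith.prod_fst
  have h2 := LipschitzWith.prod_snd (α := ℝ) (β := ℝ) |>.add h
  have h3 (c : ℝ) := (lipschitzWith_smul c).comp h2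
  have h4 := (lipschitzWith_smul α).comp (LipschitzWith.prod_fst (α := ℝ) (β := ℝ))
  exact ⟨_, ((h3 (2 * β)).sub h4).prodMk (h3 (-2))⟩

/-- The flow of `spinField α β`, as a function of the initial point and of time. -/
noncomputable def spinFlow (α β : ℝ) (p : ℝ × ℝ) : ℝ → ℝ × ℝ :=
  (exists_isIntegralCurve_of_lipschitzWith (exists_lipschitzWith_spinField α β).choose_spec
    (contDiff_spinField α β) p).choose

section SpinFlow

variable {α β : ℝ}

theorem spinFlow_zero (p : ℝ × ℝ) : spinFlow α β p 0 = p :=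
  (exists_isIntegralCurve_of_lipschitzWith (exists_lipschitzWith_spinField α β).choose_spec
    (contDiff_spinField α β) p).choose_spec.1

theorem isIntegralCurve_spinFlow (p : ℝ × ℝ) :
    IsIntegralCurve (spinFlow α β p) (fun _ => spinField α β) :=
  (exists_isIntegralCurve_of_lipschitzWith (exists_lipschitzWith_spinField α β).choose_spec
    (contDiff_spinField α β) p).choose_spec.2

theorem continuous_spinFlow (p : ℝ × ℝ) : Continuous (spinFlow α β p) :=
  (isIntegralCurve_spinFlow p).continuous

theorem eq_spinFlow_of_isIntegralCurve {x : ℝ → ℝ × ℝ}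
    (hx : IsIntegralCurve x (fun _ => spinField α β)) : x = spinFlow α β (x 0) := by
  obtain ⟨K, hK⟩ := exists_lipschitzWith_spinField α β
  exact hx.eq_of_lipschitzWith hK (isIntegralCurve_spinFlow _) (t₀ := 0) (spinFlow_zero _).symm

theorem IsForwardTrajectory.eq_spinFlow {x : ℝ → ℝ × ℝ}
    (hx : IsForwardTrajectory (spinField α β) x) {t : ℝ} (ht : 0 ≤ t) :
    x t = spinFlow α β (x 0) t := by
  obtain ⟨K, hK⟩ := exists_lipschitzWith_spinField α β
  exact IsIntegralCurveOn.eqOn_Ici_of_lipschitzWith hK hx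
    ((isIntegralCurve_spinFlow (x 0)).isIntegralCurveOn _) (spinFlow_zero _).symm ht

theorem isForwardTrajectory_spinFlow (p : ℝ × ℝ) :
    IsForwardTrajectory (spinField α β) (spinFlow α β p) :=
  (isIntegralCurve_spinFlow p).isIntegralCurveOn _

theorem spinFlow_add (p : ℝ × ℝ) (s t : ℝ) :
    spinFlow α β (spinFlow α β p s) t = spinFlow α β p (t + s) := by
  have h := eq_spinFlow_of_isIntegralCurve ((isIntegralCurve_spinFlow (α := α) (β := β) p).comp_add s)
  have h2 := congrFun h t
  simp only [Function.comp_apply, zero_add] at h2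
  exact h2.symm

theorem spinField_neg (p : ℝ × ℝ) : spinField α β (-p) = -spinField α β p := by
  simp only [spinField, Prod.fst_neg, Prod.snd_neg, Real.tanh_neg, Prod.neg_mk, Prod.mk.injEq]
  constructor <;> ring

theorem spinField_zero : spinField α β 0 = 0 := by
  simp [spinField]

theorem spinFlow_neg (p : ℝ × ℝ) (t : ℝ) : spinFlow α β (-p) t = -spinFlow α β p t := by
  have h : IsIntegralCurve (fun t => -spinFlow α β p t) (fun _ => spinField α β) := fun t => by
    change HasDerivAt _ (spinField α β (-_)) t
    rw [spinField_neg]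
    exact (isIntegralCurve_spinFlow p t).neg
  have h2 := congrFun (eq_spinFlow_of_isIntegralCurve h) t
  simp only [spinFlow_zero] at h2
  exact h2.symm

theorem spinFlow_of_zero (t : ℝ) : spinFlow α β 0 t = 0 := by
  have h : IsIntegralCurve (fun _ : ℝ => (0 : ℝ × ℝ)) (fun _ => spinField α β) := fun t => by
    change HasDerivAt _ (spinField α β 0) t
    rw [spinField_zero]
    exact hasDerivAt_const t 0
  exact (congrFun (eq_spinFlow_of_isIntegralCurve h) t).symm

theorem spinFlow_ne_zero {p : ℝ × ℝ} (hp : p ≠ 0) (t : ℝ) : spinFlow α β p t ≠ 0 := by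
  intro h
  apply hp
  have h2 := spinFlow_add (α := α) (β := β) p t (-t)
  rw [h, spinFlow_of_zero, neg_add_cancel, spinFlow_zero] at h2
  exact h2.symm

/-- On bounded time intervals the flow is Lipschitz in the initial point. -/
theorem exists_dist_spinFlow_le (α β : ℝ) : ∃ K : NNReal, ∀ p q : ℝ × ℝ, ∀ t, 0 ≤ t →
    dist (spinFlow α β p t) (spinFlow α β q t) ≤ dist p q * Real.exp (K * t) := by
  obtain ⟨K, hK⟩ := exists_lipschitzWith_spinField α β
  refine ⟨K, fun p q t ht => ?_⟩
  have h := dist_le_of_trajectories_ODE (v := fun _ => spinField α β) (K := K) (a := 0) (b := t)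
    (δ := dist p q) (fun _ => hK) (continuous_spinFlow p).continuousOn
    (fun s _ => (isIntegralCurve_spinFlow p s).hasDerivWithinAt) (continuous_spinFlow q).continuousOn
    (fun s _ => (isIntegralCurve_spinFlow q s).hasDerivWithinAt)
    (by rw [spinFlow_zero, spinFlow_zero]) t ⟨ht, le_rfl⟩
  simpa using h

theorem continuous_spinFlow_left {t : ℝ} (ht : 0 ≤ t) : Continuous fun p => spinFlow α β p t := by
  obtain ⟨K, hK⟩ := exists_dist_spinFlow_le α β
  refine (LipschitzWith.of_dist_le_mul (K := ⟨Real.exp (K * t), (Real.exp_pos _).le⟩)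
    fun p q => ?_).continuous
  rw [mul_comm]
  exact hK p q t ht

theorem attractsFrom_of_tendsto {A : Set (ℝ × ℝ)} {p : ℝ × ℝ}
    (h : Tendsto (fun t => Metric.infDist (spinFlow α β p t) A) atTop (𝓝 0)) :
    AttractsFrom (spinField α β) A p := by
  refine ⟨⟨_, isForwardTrajectory_spinFlow p, spinFlow_zero p⟩, fun x hx hp => ?_⟩
  refine h.congr' ?_
  filter_upwards [eventually_ge_atTop 0] with t ht
  rw [hx.eq_spinFlow ht, hp]

end SpinFlow

/-! ### Limit sets and Lyapunov functions. -/

section LaSalle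

variable {α β : ℝ}

/-- Continuity in the initial point makes the limit set forward invariant. -/
theorem mapClusterPt_spinFlow {p q : ℝ × ℝ} (hq : MapClusterPt q atTop (spinFlow α β p)) {s : ℝ}
    (hs : 0 ≤ s) : MapClusterPt (spinFlow α β q s) atTop (spinFlow α β p) := by
  have h := hq.continuousAt_comp (continuous_spinFlow_left (α := α) (β := β) hs).continuousAt
  have h2 : (fun p => spinFlow α β p s) ∘ spinFlow α β p =
      spinFlow α β p ∘ fun t => s + t := by
    funext t
    exact spinFlow_add p t s
  rw [h2] at h
  exact h.of_comp (tendsto_atTop_add_const_left _ s tendsto_id)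

/-- LaSalle's invariance principle: a function that decreases along an orbit takes the same value
at all its limit points. -/
theorem apply_le_apply_of_mapClusterPt {x : ℝ → ℝ × ℝ} {V : ℝ × ℝ → ℝ} (hV : Continuous V)
    (hx : AntitoneOn (fun t => V (x t)) (Ici 0)) {q q' : ℝ × ℝ} (hq : MapClusterPt q atTop x)
    (hq' : MapClusterPt q' atTop x) : V q ≤ V q' := by
  -- A monotone function of time never falls below its value at a limit point.
  have h1 : ∀ t, 0 ≤ t → V q ≤ V (x t) := by
    intro t ht
    by_contra! hlt
    have hf := hq.frequently (hV.continuousAt.eventually_const_lt hlt)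
    obtain ⟨s, hs, hts⟩ := (hf.and_eventually (eventually_ge_atTop t)).exists
    exact absurd (hx ht (ht.trans hts) hts) (not_le.2 hs)
  by_contra! hlt
  have hf := hq'.frequently (hV.continuousAt.eventually_lt_const hlt)
  obtain ⟨s, hs, hts⟩ := (hf.and_eventually (eventually_ge_atTop 0)).exists
  exact absurd (h1 s hts) (not_le.2 hs)

theorem tendsto_zero_of_antitoneOn {p : ℝ × ℝ} {V : ℝ × ℝ → ℝ} (hV : Continuous V) {R : ℝ}
    (hR : ∀ t, 0 ≤ t → ‖spinFlow α β p t‖ ≤ R)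
    (hx : AntitoneOn (fun t => V (spinFlow α β p t)) (Ici 0))
    (h0 : ∀ q, (∀ s, 0 ≤ s → V (spinFlow α β q s) = V q) → q = 0) :
    Tendsto (spinFlow α β p) atTop (𝓝 0) := by
  refine (isCompact_closedBall (0 : ℝ × ℝ) R).tendsto_nhds_of_unique_mapClusterPt ?_ ?_
  · filter_upwards [eventually_ge_atTop 0] with t ht
    simpa using hR t ht
  · intro q _ hq
    refine h0 q fun s hs => ?_
    exact le_antisymm (apply_le_apply_of_mapClusterPt hV hx (mapClusterPt_spinFlow hq hs) hq)
      (apply_le_apply_of_mapClusterPt hV hx hq (mapClusterPt_spinFlow hq hs))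

/-- The quadratic lower bound turns decrease of `V` into both stability and boundedness. In `h0`
only `s > 0` appears, since constancy of `V` for nonnegative times determines a two-sided derivative
only there. -/
theorem isGlobalAttractor_of_lyapunov {V W : ℝ × ℝ → ℝ} {C : ℝ} (hC : 0 < C) (hV : Continuous V)
    (hV0 : V 0 = 0) (hVC : ∀ p, ‖p‖ ^ 2 ≤ C * V p)
    (hd : ∀ p t, HasDerivAt (fun t => V (spinFlow α β p t)) (W (spinFlow α β p t)) t)
    (hW : ∀ p, W p ≤ 0) (h0 : ∀ q, (∀ s, 0 < s → W (spinFlow α β q s) = 0) → q = 0) :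
    IsGlobalAttractor (spinField α β) 0 := by
  have hanti : ∀ p, Antitone fun t => V (spinFlow α β p t) := fun p =>
    antitone_of_deriv_nonpos (fun t => (hd p t).differentiableAt) fun t => by
      rw [(hd p t).deriv]
      exact hW _
  have hle : ∀ p t, 0 ≤ t → ‖spinFlow α β p t‖ ^ 2 ≤ C * V p := fun p t ht => by
    refine (hVC _).trans (mul_le_mul_of_nonneg_left ?_ hC.le)
    simpa [spinFlow_zero] using hanti p ht
  refine ⟨spinField_zero, fun ε hε => ?_, fun p => ?_⟩
  · have hlt : V 0 < ε ^ 2 / C := by rw [hV0]; positivity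
    obtain ⟨δ, hδ, h⟩ := Metric.eventually_nhds_iff.1 (hV.continuousAt.eventually_lt_const hlt)
    refine ⟨δ, hδ, fun x hx hx0 t ht => ?_⟩
    have h1 := h hx0
    rw [lt_div_iff₀ hC] at h1
    rw [hx.eq_spinFlow ht, dist_zero_right]
    refine lt_of_pow_lt_pow_left₀ 2 hε.le ?_
    linarith [hle (x 0) t ht]
  · apply attractsFrom_of_tendsto
    have h1 : Tendsto (spinFlow α β p) atTop (𝓝 0) := by
      refine tendsto_zero_of_antitoneOn hV (R := Real.sqrt (C * V p)) (fun t ht => ?_)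
        ((hanti p).antitoneOn _) fun q hq => h0 q fun s hs => ?_
      · exact Real.le_sqrt_of_sq_le (hle p t ht)
      · refine (hd q s).unique ((hasDerivAt_const s (V q)).congr_of_eventuallyEq ?_)
        filter_upwards [eventually_gt_nhds hs] with r hr
        exact hq r hr.le
    simpa [Metric.infDist_singleton] using h1.norm

end LaSalle

/-- The damping function of the Liénard form of the system in the coordinates `lam`,
`lam + β m`. -/
noncomputable def lienardDamping (α β x : ℝ) : ℝ := (α + 2) * x - 2 * β * Real.tanh x

/-! ### Liénard coordinates, and global attraction below the threshold. -/

section Lienard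

variable {α β : ℝ}

theorem hasDerivAt_spinFlow_fst (p : ℝ × ℝ) (t : ℝ) :
    HasDerivAt (fun t => (spinFlow α β p t).1) (2 * ((spinFlow α β p t).1 +
      β * (spinFlow α β p t).2) - lienardDamping α β (spinFlow α β p t).1) t := by
  have h : HasDerivAt (fun t => (spinFlow α β p t).1) _ t :=
    hasFDerivAt_fst.comp_hasDerivAt t (isIntegralCurve_spinFlow (α := α) (β := β) p t)
  refine h.congr_deriv ?_
  simp only [spinField, lienardDamping, ContinuousLinearMap.coe_fst']
  ring

theorem hasDerivAt_spinFlow_snd (p : ℝ × ℝ) (t : ℝ) :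
    HasDerivAt (fun t => (spinFlow α β p t).2) (-2 * ((spinFlow α β p t).2 +
      Real.tanh (spinFlow α β p t).1)) t := by
  have h : HasDerivAt (fun t => (spinFlow α β p t).2) _ t :=
    hasFDerivAt_snd.comp_hasDerivAt t (isIntegralCurve_spinFlow (α := α) (β := β) p t)
  exact h

theorem hasDerivAt_spinFlow_lienard (p : ℝ × ℝ) (t : ℝ) :
    HasDerivAt (fun t => (spinFlow α β p t).1 + β * (spinFlow α β p t).2)
      (-α * (spinFlow α β p t).1) t := by
  refine ((hasDerivAt_spinFlow_fst p t).add
    ((hasDerivAt_spinFlow_snd p t).const_mul β)).congr_deriv ?_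
  simp only [lienardDamping]
  ring

/-- The weight `α / 2` is chosen so that the mixed terms `± 2 α lam y` cancel. -/
theorem hasDerivAt_energy (p : ℝ × ℝ) (t : ℝ) :
    HasDerivAt (fun t => α / 2 * (spinFlow α β p t).1 ^ 2 +
      ((spinFlow α β p t).1 + β * (spinFlow α β p t).2) ^ 2)
      (-α * ((spinFlow α β p t).1 * lienardDamping α β (spinFlow α β p t).1)) t := by
  refine ((((hasDerivAt_spinFlow_fst p t).fun_pow 2).const_mul (α / 2)).add
    ((hasDerivAt_spinFlow_lienard p t).fun_pow 2)).congr_deriv ?_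
  ring

theorem lienardDamping_neg (x : ℝ) : lienardDamping α β (-x) = -lienardDamping α β x := by
  simp only [lienardDamping, Real.tanh_neg]
  ring

theorem lienardDamping_zero : lienardDamping α β 0 = 0 := by
  simp [lienardDamping]

theorem continuous_lienardDamping : Continuous (lienardDamping α β) := by
  unfold lienardDamping
  have := continuous_tanh
  fun_prop

theorem mul_lienardDamping_pos (hα : 0 < α) (h : β ≤ α / 2 + 1) (hβ : 0 ≤ β) {x : ℝ} (hx : x ≠ 0) :
    0 < x * lienardDamping α β x := by
  have key : ∀ x, 0 < x → 0 < x * lienardDamping α β x := fun x hx => by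
    refine mul_pos hx ?_
    have h1 := tanh_lt_self hx
    have h2 := tanh_pos hx
    rw [lienardDamping, sub_pos]
    rcases hβ.eq_or_lt with rfl | hβ
    · simp only [mul_zero, zero_mul]
      positivity
    · nlinarith
  rcases hx.lt_or_gt with hx | hx
  · have := key (-x) (by linarith)
    rw [lienardDamping_neg] at this
    linarith
  · exact key x hx

/-- On the axis `lam = 0` the velocity of `lam` is `2 β m`, so an orbit staying there also has `m =
0`. -/
theorem eq_zero_of_spinFlow_fst_eq_zero {q : ℝ × ℝ} (hβ : β ≠ 0)
    (h : ∀ s, 0 < s → (spinFlow α β q s).1 = 0) : q = 0 := by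
  by_contra hq
  apply spinFlow_ne_zero (α := α) (β := β) hq 1
  have h1 := h 1 one_pos
  have h2 : HasDerivAt (fun t => (spinFlow α β q t).1) 0 1 := by
    refine (hasDerivAt_const (1 : ℝ) (0 : ℝ)).congr_of_eventuallyEq ?_
    filter_upwards [eventually_gt_nhds (one_pos : (0 : ℝ) < 1)] with r hr
    exact h r hr
  have h3 := (hasDerivAt_spinFlow_fst q 1).unique h2
  rw [h1, lienardDamping_zero] at h3
  ext
  · exact h1
  · simpa [hβ] using h3

theorem norm_sq_le_sq_add_sq (p : ℝ × ℝ) : ‖p‖ ^ 2 ≤ p.1 ^ 2 + p.2 ^ 2 := by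
  rw [Prod.norm_def]
  rcases max_choice ‖p.1‖ ‖p.2‖ with h | h <;> rw [h, Real.norm_eq_abs, sq_abs] <;>
    nlinarith [sq_nonneg p.1, sq_nonneg p.2]

theorem isGlobalAttractor_zero (hα : 0 < α) (hβ : 0 ≤ β) (h : β ≤ α / 2 + 1) :
    IsGlobalAttractor (spinField α β) 0 := by
  rcases hβ.eq_or_lt with rfl | hβ
  -- For `β = 0` the Liénard energy does not see `m`.
  · refine isGlobalAttractor_of_lyapunov (V := fun p => p.2 ^ 2 / 2 + p.1 ^ 2 / α)
      (W := fun p => -2 * p.2 ^ 2 - 2 * p.2 * Real.tanh p.1 - 2 * p.1 ^ 2) (C := 2 + α)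
      (by positivity) (by fun_prop) (by simp) (fun p => ?_) (fun p t => ?_) ?_ ?_
    · refine (norm_sq_le_sq_add_sq p).trans ?_
      have : (2 + α) * (p.2 ^ 2 / 2 + p.1 ^ 2 / α) =
        p.1 ^ 2 + p.2 ^ 2 + (α * p.2 ^ 2 / 2 + 2 * p.1 ^ 2 / α) := by field_simp; ring
      rw [this]
      have : 0 ≤ α * p.2 ^ 2 / 2 + 2 * p.1 ^ 2 / α := by positivity
      linarith
    · refine ((((hasDerivAt_spinFlow_snd p t).fun_pow 2).div_const 2).add
        (((hasDerivAt_spinFlow_fst p t).fun_pow 2).div_const α)).congr_deriv ?_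
      simp only [lienardDamping]
      field_simp
      ring
    all_goals
      have key : ∀ p : ℝ × ℝ, -2 * p.2 ^ 2 - 2 * p.2 * Real.tanh p.1 - 2 * p.1 ^ 2 ≤
          -(p.1 ^ 2 + p.2 ^ 2) := fun p => by
        have h1 := lipschitzWith_tanh.dist_le_mul p.1 0
        simp only [Real.tanh_zero, dist_zero_right, Real.norm_eq_abs, NNReal.coe_one, one_mul] at h1
        have h2 := sq_le_sq' (by linarith [abs_nonneg (Real.tanh p.1), abs_nonneg p.1]) h1
        rw [sq_abs, sq_abs] at h2
        nlinarith [sq_nonneg (p.2 + Real.tanh p.1)]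
    · intro p
      nlinarith [key p, sq_nonneg p.1, sq_nonneg p.2]
    · intro q hq
      by_contra hq0
      refine spinFlow_ne_zero (α := α) (β := 0) hq0 1 ?_
      have h1 := key (spinFlow α 0 q 1)
      rw [hq 1 one_pos] at h1
      have h2 := norm_sq_le_sq_add_sq (spinFlow α 0 q 1)
      have h3 : ‖spinFlow α 0 q 1‖ ^ 2 = 0 := le_antisymm (by linarith) (sq_nonneg _)
      simpa using h3
  · refine isGlobalAttractor_of_lyapunov
      (V := fun p => α / 2 * p.1 ^ 2 + (p.1 + β * p.2) ^ 2)
      (W := fun p => -α * (p.1 * lienardDamping α β p.1))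
      -- The summands bound `lam²` and `m²`: `lam² ≤ (2/α) V`, and `(β m)² = (y - lam)² ≤ 2 y² + 2
      -- lam² ≤ (2 + 4/α) V`.
      (C := 2 / α + (2 + 4 / α) / β ^ 2)
      (by positivity) (by fun_prop) (by simp) (fun p => ?_) hasDerivAt_energy ?_ ?_
    · refine (norm_sq_le_sq_add_sq p).trans ?_
      have h1 : p.1 ^ 2 ≤ 2 / α * (α / 2 * p.1 ^ 2 + (p.1 + β * p.2) ^ 2) := by
        have : 2 / α * (α / 2 * p.1 ^ 2 + (p.1 + β * p.2) ^ 2) =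
          p.1 ^ 2 + 2 / α * (p.1 + β * p.2) ^ 2 := by field_simp
        rw [this]
        have : 0 ≤ 2 / α * (p.1 + β * p.2) ^ 2 := by positivity
        linarith
      have h2 : p.2 ^ 2 ≤ (2 + 4 / α) / β ^ 2 * (α / 2 * p.1 ^ 2 + (p.1 + β * p.2) ^ 2) := by
        rw [div_mul_eq_mul_div, le_div_iff₀ (by positivity)]
        have h3 : (2 + 4 / α) * (α / 2 * p.1 ^ 2 + (p.1 + β * p.2) ^ 2) =
          2 * (α / 2 * p.1 ^ 2 + (p.1 + β * p.2) ^ 2) +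
            2 * (2 / α * (α / 2 * p.1 ^ 2 + (p.1 + β * p.2) ^ 2)) := by ring
        rw [h3]
        nlinarith [sq_nonneg (2 * p.1 + β * p.2), mul_nonneg hα.le (sq_nonneg p.1)]
      rw [add_mul]
      exact add_le_add h1 h2
    · intro p
      rcases eq_or_ne p.1 0 with h0 | h0
      · simp [h0]
      · nlinarith [mul_lienardDamping_pos hα h hβ.le h0]
    · intro q hq
      refine eq_zero_of_spinFlow_fst_eq_zero (α := α) hβ.ne' fun s hs => ?_
      by_contra h0
      have h1 := hq s hs
      have h2 := mul_lienardDamping_pos hα h hβ.le h0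
      nlinarith
end Lienard

/-! ### One-sided comparison and first zeros. -/

section RealFunctions

theorem HasDerivAt.eventually_lt_right {f : ℝ → ℝ} {f' x : ℝ} (h : HasDerivAt f f' x)
    (hf : 0 < f') : ∀ᶠ y in 𝓝[>] x, f x < f y := by
  have h1 := (hasDerivAt_iff_tendsto_slope.1 h).eventually (eventually_gt_nhds hf)
  have h2 : ∀ᶠ y in 𝓝[>] x, 0 < slope f x y :=
    h1.filter_mono (nhdsWithin_mono _ fun y hy => ne_of_gt hy)
  filter_upwards [h2, self_mem_nhdsWithin] with y hy hxy
  rw [slope_def_field] at hy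
  have := (div_pos_iff_of_pos_right (sub_pos.2 hxy)).1 hy
  linarith

theorem HasDerivAt.eventually_lt_left {f : ℝ → ℝ} {f' x : ℝ} (h : HasDerivAt f f' x)
    (hf : 0 < f') : ∀ᶠ y in 𝓝[<] x, f y < f x := by
  have h1 := (hasDerivAt_iff_tendsto_slope.1 h).eventually (eventually_gt_nhds hf)
  have h2 : ∀ᶠ y in 𝓝[<] x, 0 < slope f x y :=
    h1.filter_mono (nhdsWithin_mono _ fun y hy => ne_of_lt hy)
  filter_upwards [h2, self_mem_nhdsWithin] with y hy hxy
  rw [slope_def_field, div_pos_iff] at hy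
  have : y < x := hxy
  rcases hy with hy | hy <;> linarith

/-- A continuous function that is positive at `s` and nonpositive later has a first zero. -/
theorem exists_first_zero {f : ℝ → ℝ} (hf : Continuous f) {s t : ℝ} (hst : s ≤ t) (hs : 0 < f s)
    (ht : f t ≤ 0) : ∃ τ, s < τ ∧ f τ = 0 ∧ ∀ r ∈ Ico s τ, 0 < f r := by
  set A := {r | s ≤ r ∧ f r ≤ 0} with hA
  have hclosed : IsClosed A := isClosed_Ici.inter (isClosed_le hf continuous_const)
  have hne : A.Nonempty := ⟨t, hst, ht⟩
  have hbdd : BddBelow A := ⟨s, fun r hr => hr.1⟩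
  have hmem := hclosed.csInf_mem hne hbdd
  have hpos : ∀ r ∈ Ico s (sInf A), 0 < f r := fun r hr => by
    by_contra! h
    exact absurd (csInf_le hbdd ⟨hr.1, h⟩) (not_le.2 hr.2)
  have hlt : s < sInf A := lt_of_le_of_ne hmem.1 fun h => by
    have h2 := hmem.2
    rw [← h] at h2
    linarith
  refine ⟨sInf A, hlt, le_antisymm hmem.2 ?_, hpos⟩
  have h1 : Tendsto f (𝓝[<] sInf A) (𝓝 (f (sInf A))) := hf.continuousAt.mono_left inf_le_left
  refine ge_of_tendsto h1 ?_
  filter_upwards [Ioo_mem_nhdsLT hlt] with r hr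
  exact (hpos r ⟨hr.1.le, hr.2⟩).le

end RealFunctions

/-! ### Shape of the damping function. -/

section Damping

variable {α β : ℝ}

theorem hasDerivAt_lienardDamping (x : ℝ) :
    HasDerivAt (lienardDamping α β) (α + 2 - 2 * β * (1 - Real.tanh x ^ 2)) x := by
  refine (((hasDerivAt_id' x).const_mul (α + 2)).fun_sub
    ((hasDerivAt_tanh x).const_mul (2 * β))).congr_deriv ?_
  ring

/-- The linear part is homogeneous, so the concavity of `tanh` decides: `F(x)/x` is strictly
increasing on the positive axis. -/
theorem mul_lienardDamping_div_lt (hβ : 0 < β) {x k : ℝ} (hx : 0 < x) (hk : 1 < k) :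
    k * lienardDamping α β (x / k) < lienardDamping α β x := by
  have h := tanh_lt_mul_tanh_div hx hk
  have hk0 : k ≠ 0 := by linarith
  have h1 : k * lienardDamping α β (x / k) =
      (α + 2) * x - 2 * β * (k * Real.tanh (x / k)) := by
    simp only [lienardDamping]
    field_simp
  rw [h1, lienardDamping]
  nlinarith

theorem div_lienardDamping_lt (hβ : 0 < β) {x x' k : ℝ} (hx : 0 < x) (hxx' : x ≤ x')
    (hk : 1 < k) : k * lienardDamping α β (x / k) / x < lienardDamping α β x' / x' := by
  have hx' := hx.trans_le hxx'
  -- Dilating by `k x' / x` sends `x / k` to `x'`.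
  have h1 : 1 < k * x' / x := by
    rw [lt_div_iff₀ hx]
    nlinarith
  have h2 := mul_lienardDamping_div_lt (α := α) hβ hx' h1
  have h3 : x' / (k * x' / x) = x / k := by field_simp
  rw [h3] at h2
  rw [lt_div_iff₀ hx']
  calc _ = k * x' / x * lienardDamping α β (x / k) := by ring
    _ < _ := h2

/-- Beyond the threshold the slope of `F` at zero is `α + 2 - 2 β < 0`. -/
theorem exists_strictAntiOn_lienardDamping (h : α / 2 + 1 < β) :
    ∃ b, 0 < b ∧ StrictAntiOn (lienardDamping α β) (Icc 0 b) := by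
  have hc : ContinuousAt (fun x => α + 2 - 2 * β * (1 - Real.tanh x ^ 2)) 0 := by
    have := continuous_tanh
    fun_prop
  have h0 : α + 2 - 2 * β * (1 - Real.tanh 0 ^ 2) < 0 := by
    rw [Real.tanh_zero]
    linarith
  obtain ⟨b, hb, hlt⟩ := Metric.eventually_nhds_iff.1 (hc.eventually_lt_const h0)
  refine ⟨b, hb, strictAntiOn_of_deriv_neg (convex_Icc 0 b)
    continuous_lienardDamping.continuousOn fun x hx => ?_⟩
  rw [interior_Icc] at hx
  rw [(hasDerivAt_lienardDamping x).deriv]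
  apply hlt
  rw [dist_zero_right, Real.norm_eq_abs, abs_of_pos hx.1]
  exact hx.2

end Damping

/-! ### Forward boundedness. -/

section Bounds

variable {α β : ℝ}

/-- The integrating factor `exp (2 t)` leaves the source `1 - tanh lam > 0`. In particular `m > -1`
persists, which later bounds the return map. -/
theorem add_one_le_spinFlow_snd (p : ℝ × ℝ) {t : ℝ} (ht : 0 ≤ t) :
    Real.exp (-2 * t) * (p.2 + 1) ≤ (spinFlow α β p t).2 + 1 := by
  have hd : ∀ t, HasDerivAt (fun t => Real.exp (2 * t) * ((spinFlow α β p t).2 + 1))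
      (Real.exp (2 * t) * (2 * (1 - Real.tanh (spinFlow α β p t).1))) t := fun t => by
    refine ((((hasDerivAt_id' t).const_mul 2).exp).fun_mul
      ((hasDerivAt_spinFlow_snd p t).add_const 1)).congr_deriv ?_
    ring
  have hm : Monotone fun t => Real.exp (2 * t) * ((spinFlow α β p t).2 + 1) :=
    monotone_of_deriv_nonneg (fun t => (hd t).differentiableAt) fun t => by
      rw [(hd t).deriv]
      have := Real.tanh_lt_one (spinFlow α β p t).1
      have : 0 ≤ 1 - Real.tanh (spinFlow α β p t).1 := by linarith
      positivity
  have h := hm ht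
  simp only [mul_zero, Real.exp_zero, one_mul, spinFlow_zero] at h
  calc _ ≤ Real.exp (-2 * t) * (Real.exp (2 * t) * ((spinFlow α β p t).2 + 1)) := by gcongr
    _ = _ := by rw [← mul_assoc, ← Real.exp_add]; simp

theorem neg_le_spinFlow_snd (p : ℝ × ℝ) {t : ℝ} (ht : 0 ≤ t) :
    -(2 + |p.2|) ≤ (spinFlow α β p t).2 := by
  have h1 := add_one_le_spinFlow_snd (α := α) (β := β) p ht
  have h2 : Real.exp (-2 * t) ≤ 1 := Real.exp_le_one_iff.2 (by linarith)
  have h3 := Real.exp_pos (-2 * t)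
  have h4 := abs_nonneg p.2
  have h5 := neg_abs_le p.2
  nlinarith

theorem abs_spinFlow_snd_le (p : ℝ × ℝ) {t : ℝ} (ht : 0 ≤ t) :
    |(spinFlow α β p t).2| ≤ 2 + |p.2| := by
  have h1 := neg_le_spinFlow_snd (α := α) (β := β) p ht
  have h2 := neg_le_spinFlow_snd (α := α) (β := β) (-p) ht
  rw [spinFlow_neg, Prod.snd_neg, Prod.snd_neg, abs_neg] at h2
  exact abs_le.2 ⟨h1, by linarith⟩

theorem neg_le_spinFlow_fst (hα : 0 < α) (hβ : 0 ≤ β) (p : ℝ × ℝ) {t : ℝ} (ht : 0 ≤ t) :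
    -(2 * (2 * β * (3 + |p.2|) / α) + |p.1|) ≤ (spinFlow α β p t).1 := by
  -- `α C` dominates the forcing `2 β (m + tanh lam)`, because `m ≥ -(2 + |p.2|)` and `tanh > -1`.
  set C := 2 * β * (3 + |p.2|) / α with hC
  have hC0 : 0 ≤ C := by positivity
  have hd : ∀ t, HasDerivAt (fun t => Real.exp (α * t) * ((spinFlow α β p t).1 + C))
      (Real.exp (α * t) * (2 * β * ((spinFlow α β p t).2 + Real.tanh (spinFlow α β p t).1) +
        α * C)) t := fun t => by
    refine ((((hasDerivAt_id' t).const_mul α).exp).fun_mul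
      ((hasDerivAt_spinFlow_fst p t).add_const C)).congr_deriv ?_
    simp only [lienardDamping]
    ring
  have hm : MonotoneOn (fun t => Real.exp (α * t) * ((spinFlow α β p t).1 + C)) (Ici 0) := by
    refine monotoneOn_of_deriv_nonneg (convex_Ici 0)
      (fun t _ => (hd t).continuousAt.continuousWithinAt)
      (fun t _ => (hd t).differentiableAt.differentiableWithinAt) fun t ht => ?_
    rw [interior_Ici] at ht
    rw [(hd t).deriv]
    have h1 := neg_le_spinFlow_snd (α := α) (β := β) p (le_of_lt ht)
    have h2 := Real.neg_one_lt_tanh (spinFlow α β p t).1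
    have h3 : α * C = 2 * β * (3 + |p.2|) := by rw [hC]; field_simp
    refine mul_nonneg (Real.exp_pos _).le ?_
    rw [h3, ← mul_add]
    exact mul_nonneg (by positivity) (by linarith)
  have h := hm (by simp) ht ht
  simp only [mul_zero, Real.exp_zero, one_mul, spinFlow_zero] at h
  have h1 : Real.exp (-α * t) * (p.1 + C) ≤ (spinFlow α β p t).1 + C := by
    calc _ ≤ Real.exp (-α * t) * (Real.exp (α * t) * ((spinFlow α β p t).1 + C)) := by gcongr
      _ = _ := by rw [← mul_assoc, ← Real.exp_add]; simp
  have h2 : Real.exp (-α * t) ≤ 1 := Real.exp_le_one_iff.2 (by nlinarith)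
  have h3 := Real.exp_pos (-α * t)
  have h4 := abs_nonneg p.1
  have h5 := neg_abs_le p.1
  nlinarith

theorem norm_spinFlow_le (hα : 0 < α) (hβ : 0 ≤ β) (p : ℝ × ℝ) :
    ∃ R, ∀ t, 0 ≤ t → ‖spinFlow α β p t‖ ≤ R := by
  refine ⟨max (2 * (2 * β * (3 + |p.2|) / α) + |p.1|) (2 + |p.2|), fun t ht => ?_⟩
  have h1 := neg_le_spinFlow_fst hα hβ p ht
  have h2 := neg_le_spinFlow_fst hα hβ (-p) ht
  rw [spinFlow_neg, Prod.fst_neg, Prod.fst_neg, Prod.snd_neg, abs_neg, abs_neg] at h2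
  exact max_le_max (abs_le.2 ⟨h1, by linarith⟩) (abs_spinFlow_snd_le p ht)

end Bounds

/-! ### Returns to the axis `lam = 0`. -/

section Crossing

variable {α β : ℝ}

theorem continuous_spinFlow_fst (p : ℝ × ℝ) : Continuous fun t => (spinFlow α β p t).1 :=
  (continuous_spinFlow p).fst

theorem continuous_spinFlow_lienard (p : ℝ × ℝ) :
    Continuous fun t => (spinFlow α β p t).1 + β * (spinFlow α β p t).2 :=
  (continuous_spinFlow p).fst.add ((continuous_spinFlow p).snd.const_mul β)

/-- If `lam` stayed positive, `y` would decrease, and LaSalle would send the orbit to the origin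
with `y ≥ 0`. Near the origin `F(lam) < 0`, so `lam' = 2 y - F(lam) > 0`, which prevents `lam` from
decaying to zero. -/
theorem exists_spinFlow_fst_nonpos (hα : 0 < α) (h : α / 2 + 1 < β) (p : ℝ × ℝ) :
    ∃ t, 0 ≤ t ∧ (spinFlow α β p t).1 ≤ 0 := by
  by_contra! hpos
  have hβ : 0 < β := by linarith
  obtain ⟨R, hR⟩ := norm_spinFlow_le hα hβ.le p
  have hanti : AntitoneOn (fun t => (spinFlow α β p t).1 + β * (spinFlow α β p t).2) (Ici 0) := by
    refine antitoneOn_of_deriv_nonpos (convex_Ici 0) (continuous_spinFlow_lienard p).continuousOn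
      (fun t _ => (hasDerivAt_spinFlow_lienard p t).differentiableAt.differentiableWithinAt)
      fun t ht => ?_
    rw [interior_Ici] at ht
    rw [(hasDerivAt_spinFlow_lienard p t).deriv]
    nlinarith [hpos t (le_of_lt ht)]
  have hlim : Tendsto (spinFlow α β p) atTop (𝓝 0) := by
    refine tendsto_zero_of_antitoneOn (V := fun p => p.1 + β * p.2) (by fun_prop) hR hanti
      fun q hq => eq_zero_of_spinFlow_fst_eq_zero (α := α) hβ.ne' fun s hs => ?_
    have h1 := (hasDerivAt_spinFlow_lienard (α := α) (β := β) q s).unique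
      ((hasDerivAt_const s (q.1 + β * q.2)).congr_of_eventuallyEq (by
        filter_upwards [eventually_gt_nhds hs] with r hr
        exact hq r hr.le))
    simpa [hα.ne'] using h1
  have hx : Tendsto (fun t => (spinFlow α β p t).1) atTop (𝓝 0) :=
    (continuous_fst.tendsto (0 : ℝ × ℝ)).comp hlim
  have hy : Tendsto (fun t => (spinFlow α β p t).1 + β * (spinFlow α β p t).2) atTop (𝓝 0) := by
    have : Continuous fun p : ℝ × ℝ => p.1 + β * p.2 := by fun_prop
    simpa [Function.comp_def] using (this.tendsto 0).comp hlim
  have hy0 : ∀ t, 0 ≤ t → 0 ≤ (spinFlow α β p t).1 + β * (spinFlow α β p t).2 := fun t ht => by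
    refine le_of_tendsto hy ?_
    filter_upwards [eventually_ge_atTop t] with s hs
    exact hanti ht (ht.trans hs) hs
  obtain ⟨b, hb, hbanti⟩ := exists_strictAntiOn_lienardDamping h
  obtain ⟨T, hT⟩ :=
    ((hx.eventually (gt_mem_nhds hb)).and (eventually_ge_atTop 0)).exists_forall_of_atTop
  have hT0 := (hT T le_rfl).2
  have hmono : MonotoneOn (fun t => (spinFlow α β p t).1) (Ici T) := by
    refine monotoneOn_of_deriv_nonneg (convex_Ici T) (continuous_spinFlow_fst p).continuousOn
      (fun t _ => (hasDerivAt_spinFlow_fst p t).differentiableAt.differentiableWithinAt)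
      fun t ht => ?_
    rw [interior_Ici] at ht
    have ht' : T ≤ t := le_of_lt ht
    rw [(hasDerivAt_spinFlow_fst p t).deriv]
    have h1 := hy0 t (hT0.trans ht')
    have h2 := hpos t (hT0.trans ht')
    have h3 := hbanti ⟨le_rfl, hb.le⟩ ⟨h2.le, (hT t ht').1.le⟩ h2
    rw [lienardDamping_zero] at h3
    linarith
  have h1 : (spinFlow α β p T).1 ≤ 0 := by
    refine ge_of_tendsto hx ?_
    filter_upwards [eventually_ge_atTop T] with s hs
    exact hmono self_mem_Ici hs hs
  exact absurd (hpos T hT0) (not_lt.2 h1)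

/-- Every orbit meets the axis `lam = 0`. -/
theorem exists_spinFlow_fst_eq_zero (hα : 0 < α) (h : α / 2 + 1 < β) (p : ℝ × ℝ) :
    ∃ t, 0 ≤ t ∧ (spinFlow α β p t).1 = 0 := by
  wlog hp : 0 ≤ p.1 generalizing p
  · obtain ⟨t, ht, h0⟩ := this (-p) (by rw [Prod.fst_neg]; linarith)
    exact ⟨t, ht, by simpa [spinFlow_neg] using h0⟩
  obtain ⟨t, ht, h0⟩ := exists_spinFlow_fst_nonpos hα h p
  have := intermediate_value_Icc' ht (continuous_spinFlow_fst (α := α) (β := β) p).continuousOn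
  obtain ⟨s, hs, hs0⟩ := this ⟨h0, by rwa [spinFlow_zero]⟩
  exact ⟨s, hs.1, hs0⟩

/-- The orbit of `(0, a / β)` stays in the half plane `lam > 0` during the time `τ`, when it
arrives at `(0, -c / β)`. -/
structure IsHalfArc (α β a τ c : ℝ) : Prop where
  left_pos : 0 < a
  time_pos : 0 < τ
  right_pos : 0 < c
  map_time : spinFlow α β (0, a / β) τ = (0, -c / β)
  fst_pos : ∀ t ∈ Ioo 0 τ, 0 < (spinFlow α β (0, a / β) t).1

theorem exists_isHalfArc (hα : 0 < α) (h : α / 2 + 1 < β) {a : ℝ} (ha : 0 < a) :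
    ∃ τ c, IsHalfArc α β a τ c := by
  have hβ : 0 < β := by linarith
  set p : ℝ × ℝ := (0, a / β) with hp
  have hp0 : p ≠ 0 := by simp [hp, ha.ne', hβ.ne']
  have hd := hasDerivAt_spinFlow_fst (α := α) (β := β) p 0
  have h0 : (spinFlow α β p 0).1 = 0 := by rw [spinFlow_zero]
  have hright := hd.eventually_lt_right (by
    rw [spinFlow_zero, hp, lienardDamping_zero, mul_div_cancel₀ _ hβ.ne']
    linarith)
  rw [h0] at hright
  obtain ⟨δ, hδ, hδpos⟩ := mem_nhdsGT_iff_exists_Ioo_subset.1 hright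
  have hδ0 : 0 < δ := hδ
  obtain ⟨t, ht, hneg⟩ := exists_spinFlow_fst_nonpos hα h (spinFlow α β p (δ / 2))
  rw [spinFlow_add] at hneg
  -- The search starts at `δ / 2` because `lam` already vanishes at time zero.
  obtain ⟨τ, hτ, hτ0, hpos⟩ := exists_first_zero (continuous_spinFlow_fst (α := α) (β := β) p)
    (by linarith : δ / 2 ≤ t + δ / 2) (hδpos ⟨by linarith, by linarith⟩) hneg
  have hpos' : ∀ t ∈ Ioo 0 τ, 0 < (spinFlow α β p t).1 := fun t ht => by
    rcases lt_or_ge t δ with h | h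
    · exact hδpos ⟨ht.1, h⟩
    · exact hpos t ⟨by linarith, ht.2⟩
  have hτpos : 0 < τ := by linarith
  have hle : (spinFlow α β p τ).2 < 0 := by
    have hne : (spinFlow α β p τ).2 ≠ 0 := fun h =>
      spinFlow_ne_zero hp0 τ (Prod.ext hτ0 h)
    -- If `m > 0` on arrival, `lam` would be increasing there and hence negative just before.
    refine lt_of_le_of_ne (not_lt.1 fun hgt => ?_) hne
    have hd' := hasDerivAt_spinFlow_fst (α := α) (β := β) p τ
    have hleft := hd'.eventually_lt_left (by
      rw [hτ0, lienardDamping_zero]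
      simpa using mul_pos hβ hgt)
    obtain ⟨s, hs, hs'⟩ := (hleft.and (Ioo_mem_nhdsLT hτpos)).exists
    rw [hτ0] at hs
    exact absurd (hpos' s hs') (not_lt.2 hs.le)
  refine ⟨τ, -(β * (spinFlow α β p τ).2), ha, hτpos, by nlinarith, ?_, hpos'⟩
  rw [← hp, neg_neg, mul_div_cancel_left₀ _ hβ.ne']
  exact Prod.ext hτ0 rfl

end Crossing

/-- An inverse of a continuous injective function on a compact set is continuous. -/
theorem continuousOn_of_rightInvOn_isCompact {X Y : Type*} [TopologicalSpace X]
    [TopologicalSpace Y] [T2Space Y] {f : X → Y} {g : Y → X} {s : Set X} {t : Set Y}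
    (hs : IsCompact s) (hf : Continuous f) (hinj : InjOn f s) (hg : MapsTo g t s)
    (hfg : ∀ y ∈ t, f (g y) = y) : ContinuousOn g t := by
  intro y hy
  refine hs.tendsto_nhds_of_unique_mapClusterPt ?_ fun x hx hcl => ?_
  · filter_upwards [self_mem_nhdsWithin] with z hz
    exact hg hz
  · refine hinj hx (hg hy) ?_
    rw [hfg y hy]
    have h1 : MapClusterPt (f x) (𝓝[t] y) (f ∘ g) := hcl.continuousAt_comp hf.continuousAt
    have h2 : Tendsto (f ∘ g) (𝓝[t] y) (𝓝 y) := by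
      refine (tendsto_id.mono_left inf_le_left).congr' ?_
      filter_upwards [self_mem_nhdsWithin] with z hz
      exact (hfg z hz).symm
    have : NeBot (𝓝 (f x) ⊓ map (f ∘ g) (𝓝[t] y)) := h1.neBot
    exact eq_of_nhds_neBot (NeBot.mono this (inf_le_inf_left _ h2))

/-- The arc of an orbit of the Liénard system in the half plane `x > 0` from `(0, a)` to `(0, -c)`,
written as a graph over the second axis. -/
structure IsLienardProfile (α β a c : ℝ) (X : ℝ → ℝ) : Prop where
  continuousOn : ContinuousOn X (Icc (-c) a)
  left : X (-c) = 0
  right : X a = 0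
  pos : ∀ y ∈ Ioo (-c) a, 0 < X y
  hasDerivAt : ∀ y ∈ Ioo (-c) a, HasDerivAt X ((lienardDamping α β (X y) - 2 * y) / (α * X y)) y

/-! ### Half arcs, their profiles and monotonicity of the return map. -/

namespace IsHalfArc

variable {α β a τ c : ℝ}

theorem fst_zero : (spinFlow α β (0, a / β) 0).1 = 0 := by rw [spinFlow_zero]

theorem lienard_zero (hβ : 0 < β) :
    (spinFlow α β (0, a / β) 0).1 + β * (spinFlow α β (0, a / β) 0).2 = a := by
  rw [spinFlow_zero]
  field_simp
  ring

theorem lienard_time (hβ : 0 < β) (h : IsHalfArc α β a τ c) :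
    (spinFlow α β (0, a / β) τ).1 + β * (spinFlow α β (0, a / β) τ).2 = -c := by
  rw [h.map_time]
  field_simp
  ring

theorem fst_nonneg (h : IsHalfArc α β a τ c) {t : ℝ} (ht : t ∈ Icc 0 τ) :
    0 ≤ (spinFlow α β (0, a / β) t).1 := by
  rcases ht.1.eq_or_lt with rfl | h0
  · rw [fst_zero]
  rcases ht.2.eq_or_lt with rfl | h1
  · rw [h.map_time]
  exact (h.fst_pos t ⟨h0, h1⟩).le

theorem strictAntiOn_lienard (hα : 0 < α) (h : IsHalfArc α β a τ c) :
    StrictAntiOn (fun t => (spinFlow α β (0, a / β) t).1 + β * (spinFlow α β (0, a / β) t).2)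
      (Icc 0 τ) := by
  refine strictAntiOn_of_deriv_neg (convex_Icc 0 τ) (continuous_spinFlow_lienard _).continuousOn
    fun t ht => ?_
  rw [interior_Icc] at ht
  rw [(hasDerivAt_spinFlow_lienard _ t).deriv]
  nlinarith [h.fst_pos t ht]

theorem right_lt (hβ : 0 < β) (h : IsHalfArc α β a τ c) : c < β := by
  have h1 := add_one_le_spinFlow_snd (α := α) (β := β) (0, a / β) h.time_pos.le
  have h2 := div_pos h.left_pos hβ
  have h3 : 0 < Real.exp (-2 * τ) * (a / β + 1) := by positivity
  rw [h.map_time] at h1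
  have h4 : -1 < -c / β := by
    simp only at h1
    linarith
  rw [lt_div_iff₀ hβ] at h4
  linarith

/-- If `c ≤ a`, then `2 y ≥ -2 a > F(b)` on the arc, so `lam = b` can only be crossed upwards; the
arc must return to zero, so it stays in `lam < b`. There `F < 0` and the energy increases from `a²`
to `c²`, a contradiction. -/
theorem left_lt_right (hα : 0 < α) (hβ : 0 < β) {b : ℝ} (hb : 0 < b)
    (hbanti : StrictAntiOn (lienardDamping α β) (Icc 0 b))
    (ha : 2 * a < -lienardDamping α β b) (h : IsHalfArc α β a τ c) : a < c := by
  by_contra! hca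
  have hlt : ∀ t ∈ Icc 0 τ, (spinFlow α β (0, a / β) t).1 < b := by
    by_contra! hex
    obtain ⟨s, hs, hbs⟩ := hex
    have := image_le_of_deriv_right_lt_deriv_boundary' (f := fun _ => b) (f' := fun _ => 0)
      (a := s) (b := τ) continuousOn_const (fun t _ => hasDerivWithinAt_const _ _ _) hbs
      (continuous_spinFlow_fst (α := α) (β := β) (0, a / β)).continuousOn
      (fun t _ => (hasDerivAt_spinFlow_fst (0, a / β) t).hasDerivWithinAt) (fun t ht hbt => by
        rw [← hbt]
        have h1 := (h.strictAntiOn_lienard hα).antitoneOn ⟨hs.1.trans ht.1, ht.2.le⟩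
          (right_mem_Icc.2 h.time_pos.le) ht.2.le
        rw [h.lienard_time hβ] at h1
        linarith) (right_mem_Icc.2 hs.2)
    simp only [h.map_time] at this
    linarith
  have hmono : StrictMonoOn (fun t => α / 2 * (spinFlow α β (0, a / β) t).1 ^ 2 +
      ((spinFlow α β (0, a / β) t).1 + β * (spinFlow α β (0, a / β) t).2) ^ 2) (Icc 0 τ) := by
    refine strictMonoOn_of_deriv_pos (convex_Icc 0 τ)
      (fun t _ => (hasDerivAt_energy _ t).continuousAt.continuousWithinAt) fun t ht => ?_
    rw [interior_Icc] at ht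
    rw [(hasDerivAt_energy _ t).deriv]
    have h1 := h.fst_pos t ht
    have h2 := hbanti ⟨le_rfl, hb.le⟩ ⟨h1.le, (hlt t ⟨ht.1.le, ht.2.le⟩).le⟩ h1
    rw [lienardDamping_zero] at h2
    have h3 := mul_pos hα (mul_pos h1 (neg_pos.2 h2))
    linarith
  have h1 := hmono (left_mem_Icc.2 h.time_pos.le) (right_mem_Icc.2 h.time_pos.le) h.time_pos
  simp only [h.lienard_time hβ, lienard_zero hβ] at h1
  rw [h.map_time, fst_zero] at h1
  nlinarith [h.right_pos]

/-- Since `y' = -α lam < 0`, `y` can replace time as parameter, and the slope of the profile is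
`lam' / y'`. -/
theorem exists_profile (hα : 0 < α) (hβ : 0 < β) (h : IsHalfArc α β a τ c) :
    ∃ X, IsLienardProfile α β a c X ∧ ∀ y ∈ Icc (-c) a, ∃ t ∈ Icc 0 τ,
      spinFlow α β (0, a / β) t = (X y, (y - X y) / β) := by
  set f := fun t => (spinFlow α β (0, a / β) t).1 + β * (spinFlow α β (0, a / β) t).2 with hf
  have hfc : Continuous f := continuous_spinFlow_lienard _
  have hanti : StrictAntiOn f (Icc 0 τ) := h.strictAntiOn_lienard hα
  have hf0 : f 0 = a := lienard_zero hβ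
  have hfτ : f τ = -c := h.lienard_time hβ
  have hsurj : ∀ y ∈ Icc (-c) a, ∃ t ∈ Icc 0 τ, f t = y := fun y hy => by
    have := intermediate_value_Icc' h.time_pos.le hfc.continuousOn
    rw [hf0, hfτ] at this
    exact this hy
  choose! g hg hfg using hsurj
  have hgc : ContinuousOn g (Icc (-c) a) :=
    continuousOn_of_rightInvOn_isCompact isCompact_Icc hfc hanti.injOn hg hfg
  have hca : -c < a := by linarith [h.left_pos, h.right_pos]
  have hga : g a = 0 := hanti.injOn (hg a ⟨hca.le, le_rfl⟩) ⟨le_rfl, h.time_pos.le⟩ (by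
    rw [hfg a ⟨hca.le, le_rfl⟩, hf0])
  have hgc' : g (-c) = τ := hanti.injOn (hg _ ⟨le_rfl, hca.le⟩) ⟨h.time_pos.le, le_rfl⟩ (by
    rw [hfg _ ⟨le_rfl, hca.le⟩, hfτ])
  have hgmem : ∀ y ∈ Ioo (-c) a, g y ∈ Ioo 0 τ := fun y hy => by
    have hy' := Ioo_subset_Icc_self hy
    have h1 := hg y hy'
    have h2 := hfg y hy'
    refine ⟨lt_of_le_of_ne h1.1 fun h0 => ?_, lt_of_le_of_ne h1.2 fun h0 => ?_⟩
    · rw [← h0, hf0] at h2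
      exact hy.2.ne h2.symm
    · rw [h0, hfτ] at h2
      exact hy.1.ne h2
  have hpos : ∀ y ∈ Ioo (-c) a, 0 < (spinFlow α β (0, a / β) (g y)).1 := fun y hy =>
    h.fst_pos _ (hgmem y hy)
  refine ⟨fun y => (spinFlow α β (0, a / β) (g y)).1, ⟨?_, ?_, ?_, hpos, fun y hy => ?_⟩,
    fun y hy => ⟨g y, hg y hy, Prod.ext rfl ?_⟩⟩
  · exact (continuous_spinFlow_fst _).comp_continuousOn hgc
  · simp only [hgc', h.map_time]
  · simp only [hga, fst_zero]
  · have hnhds := Icc_mem_nhds hy.1 hy.2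
    have hfy := hfg y (Ioo_subset_Icc_self hy)
    have hx := hpos y hy
    have h1 : HasDerivAt g (-α * (spinFlow α β (0, a / β) (g y)).1)⁻¹ y := by
      refine HasDerivAt.of_local_left_inverse (hgc.continuousAt hnhds)
        (hasDerivAt_spinFlow_lienard (0, a / β) (g y)) ?_ ?_
      · exact mul_ne_zero (neg_ne_zero.2 hα.ne') hx.ne'
      · filter_upwards [hnhds] with z hz
        exact hfg z hz
    refine ((hasDerivAt_spinFlow_fst (0, a / β) (g y)).comp y h1).congr_deriv ?_
    simp only [hf] at hfy
    rw [hfy]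
    field_simp
    ring
  · have := hfg y hy
    simp only [hf] at this ⊢
    rw [eq_div_iff hβ.ne']
    linarith

/-- Two half arcs with a common point coincide. -/
theorem left_eq_of_spinFlow_eq (hβ : 0 < β) {a' τ' c' t t' : ℝ}
    (h : IsHalfArc α β a τ c) (h' : IsHalfArc α β a' τ' c') (ht : t ∈ Icc 0 τ)
    (ht' : t' ∈ Icc 0 τ')
    (heq : spinFlow α β (0, a / β) t = spinFlow α β (0, a' / β) t') : a = a' := by
  wlog hle : t ≤ t' generalizing a a' τ τ' c c' t t'
  · exact (this h' h ht' ht heq.symm (not_le.1 hle).le).symm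
  have h1 : spinFlow α β (0, a' / β) (t' - t) = (0, a / β) := by
    have h2 := spinFlow_add (α := α) (β := β) (0, a / β) t (-t)
    rw [heq, spinFlow_add, neg_add_cancel, spinFlow_zero, neg_add_eq_sub] at h2
    exact h2
  -- A half arc meets the axis only at its two ends, and its terminal end has `m < 0`.
  have hmem : t' - t ∈ Icc 0 τ' := ⟨by linarith, by linarith [ht.1, ht'.2]⟩
  rcases hmem.1.eq_or_lt with h0 | h0
  · rw [← h0, spinFlow_zero, Prod.mk.injEq, div_left_inj' hβ.ne'] at h1
    exact h1.2.symm
  rcases hmem.2.eq_or_lt with h2 | h2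
  · rw [h2, h'.map_time, Prod.mk.injEq, div_left_inj' hβ.ne'] at h1
    linarith [h.left_pos, h'.right_pos]
  · have := h'.fst_pos _ ⟨h0, h2⟩
    rw [h1] at this
    exact absurd this (lt_irrefl _)

/-- Otherwise `X' - X` changes sign between `-c'` and `a`, so the two arcs share a point. -/
theorem right_lt_right (hα : 0 < α) (hβ : 0 < β) {a' τ' c' : ℝ} (h : IsHalfArc α β a τ c)
    (h' : IsHalfArc α β a' τ' c') (haa' : a < a') : c < c' := by
  by_contra! hcc'
  obtain ⟨X, hX, hXt⟩ := h.exists_profile hα hβ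
  obtain ⟨X', hX', hXt'⟩ := h'.exists_profile hα hβ
  have ha := h.left_pos
  have hc' := h'.right_pos
  have hcont : ContinuousOn (fun y => X' y - X y) (Icc (-c') a) :=
    (hX'.continuousOn.mono (Icc_subset_Icc le_rfl haa'.le)).sub
      (hX.continuousOn.mono (Icc_subset_Icc (by linarith) le_rfl))
  have hX0 : 0 ≤ X (-c') := by
    rcases hcc'.eq_or_lt with rfl | hlt
    · exact hX.left.ge
    · exact (hX.pos _ ⟨by linarith, by linarith⟩).le
  obtain ⟨y, hy, hy0⟩ := intermediate_value_Icc (by linarith : -c' ≤ a) hcont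
    (show (0 : ℝ) ∈ _ from ⟨by linarith [hX'.left], by
      have := hX'.pos a ⟨by linarith, haa'⟩
      linarith [hX.right]⟩)
  simp only at hy0
  obtain ⟨t, ht, hty⟩ := hXt y ⟨by linarith [hy.1], hy.2⟩
  obtain ⟨t', ht', hty'⟩ := hXt' y ⟨hy.1, by linarith [hy.2]⟩
  have hXX' : X y = X' y := by linarith
  refine haa'.ne (left_eq_of_spinFlow_eq hβ h h' ht ht' ?_)
  rw [hty, hty', hXX']

end IsHalfArc

/-! ### Comparison of an arc with a dilated arc. -/

namespace IsLienardProfile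

variable {α β a c c' k : ℝ} {X Y : ℝ → ℝ}

/-- Dilation preserves the profile equation except that `F(x)` becomes `k F(x / k)`, which is
smaller for `k > 1` and `β > 0`. -/
theorem hasDerivAt_dilation (hk : 0 < k) (hX : IsLienardProfile α β a c X) {y : ℝ}
    (hy : y ∈ Ioo (-(k * c)) (k * a)) : HasDerivAt (fun y => k * X (y / k))
      ((k * lienardDamping α β (X (y / k)) - 2 * y) / (α * (k * X (y / k)))) y := by
  have hyk : y / k ∈ Ioo (-c) a := by
    rw [mem_Ioo, lt_div_iff₀ hk, div_lt_iff₀ hk]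
    constructor <;> linarith [hy.1, hy.2]
  refine (((hX.hasDerivAt _ hyk).comp y ((hasDerivAt_id' y).div_const k)).const_mul k).congr_deriv ?_
  rcases eq_or_ne α 0 with rfl | hα
  · simp
  have := hX.pos _ hyk
  field_simp

theorem continuousOn_dilation (hk : 0 < k) (hX : IsLienardProfile α β a c X) :
    ContinuousOn (fun y => k * X (y / k)) (Icc (-(k * c)) (k * a)) := by
  refine (hX.continuousOn.comp (continuous_id.div_const k).continuousOn fun y hy => ?_).const_smul k
  rw [id, mem_Icc, le_div_iff₀ hk, div_le_iff₀ hk]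
  constructor <;> linarith [hy.1, hy.2]

theorem pos_dilation (hk : 0 < k) (hX : IsLienardProfile α β a c X) {y : ℝ}
    (hy : y ∈ Ioo (-(k * c)) (k * a)) : 0 < k * X (y / k) := by
  refine mul_pos hk (hX.pos _ ?_)
  rw [mem_Ioo, lt_div_iff₀ hk, div_lt_iff₀ hk]
  constructor <;> linarith [hy.1, hy.2]

/-- The profile issued from `k a` stays strictly inside the dilation by `k > 1` of the profile
issued from `a`. -/
theorem lt_dilation (hα : 0 < α) (hβ : 0 < β) (hk : 1 < k) (ha : 0 < a) (hc : 0 < c)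
    (hX : IsLienardProfile α β a c X) (hY : IsLienardProfile α β (k * a) c' Y)
    (hcc' : k * c ≤ c') {y : ℝ} (hy : y ∈ Ioo (-(k * c)) (k * a)) : Y y < k * X (y / k) := by
  by_contra! hle
  have hk0 : 0 < k := by linarith
  have hka := mul_pos hk0 ha
  have hkc := mul_pos hk0 hc
  have hYmem : ∀ z ∈ Ioo (-(k * c)) (k * a), z ∈ Ioo (-c') (k * a) := fun z hz =>
    ⟨by linarith [hz.1], hz.2⟩
  -- At a contact point the dilated profile has the smaller slope, so the reversed inequality
  -- propagates to the right.
  have hle' : ∀ z ∈ Icc y (k * a), k * X (z / k) ≤ Y z := fun z hz => by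
    refine image_le_of_deriv_right_lt_deriv_boundary'
      ((hX.continuousOn_dilation hk0).mono (Icc_subset_Icc hy.1.le le_rfl))
      (fun z hz => (hX.hasDerivAt_dilation hk0 ⟨hy.1.trans_le hz.1, hz.2⟩).hasDerivWithinAt)
      hle (hY.continuousOn.mono (Icc_subset_Icc (hYmem y hy).1.le le_rfl))
      (fun z hz => (hY.hasDerivAt z (hYmem z ⟨hy.1.trans_le hz.1, hz.2⟩)).hasDerivWithinAt)
      (fun z hz heq => ?_) hz
    have hpos := hX.pos_dilation hk0 (y := z) ⟨hy.1.trans_le hz.1, hz.2⟩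
    rw [← heq]
    refine div_lt_div_of_pos_right ?_ (mul_pos hα hpos)
    have := mul_lienardDamping_div_lt (α := α) hβ hpos hk
    rw [mul_div_cancel_left₀ _ hk0.ne'] at this
    linarith
  -- For `z ≥ 0` the term `-2 z / x` is nondecreasing in `x`, as is `F(x)/x`. So the gap,
  -- nonnegative at `z₀`, strictly increases, yet it vanishes at `k a`.
  set z₀ := max y 0 with hz₀
  have hz₀a : z₀ < k * a := max_lt hy.2 hka
  have hmem : ∀ z ∈ Icc z₀ (k * a), z ∈ Icc y (k * a) := fun z hz =>
    ⟨(le_max_left _ _).trans hz.1, hz.2⟩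
  have hmono : StrictMonoOn (fun z => Y z - k * X (z / k)) (Icc z₀ (k * a)) := by
    refine strictMonoOn_of_hasDerivWithinAt_pos (convex_Icc _ _)
      (f' := fun z => (lienardDamping α β (Y z) - 2 * z) / (α * Y z) -
        (k * lienardDamping α β (X (z / k)) - 2 * z) / (α * (k * X (z / k))))
      ((hY.continuousOn.mono fun z hz => ?_).sub
        ((hX.continuousOn_dilation hk0).mono fun z hz => ?_)) (fun z hz => ?_) fun z hz => ?_
    · exact ⟨(hYmem y hy).1.le.trans (hmem z hz).1, hz.2⟩
    · exact ⟨hy.1.le.trans (hmem z hz).1, hz.2⟩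
    all_goals
      rw [interior_Icc] at hz
      have hzmem : z ∈ Ioo (-(k * c)) (k * a) :=
        ⟨hy.1.trans_le (hmem z (Ioo_subset_Icc_self hz)).1, hz.2⟩
    · exact ((hY.hasDerivAt z (hYmem z hzmem)).fun_sub
        (hX.hasDerivAt_dilation hk0 hzmem)).hasDerivWithinAt
    · have h1 := hX.pos_dilation hk0 hzmem
      have h2 := hY.pos z (hYmem z hzmem)
      have h3 := hle' z (hmem z (Ioo_subset_Icc_self hz))
      have h4 := div_lienardDamping_lt (α := α) hβ h1 h3 hk
      rw [mul_div_cancel_left₀ _ hk0.ne'] at h4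
      have hz0 : 0 ≤ z := (le_max_right _ _).trans hz.1.le
      have h5 : 2 * z / Y z ≤ 2 * z / (k * X (z / k)) :=
        div_le_div_of_nonneg_left (by linarith) h1 h3
      have h6 : (k * lienardDamping α β (X (z / k)) - 2 * z) / (k * X (z / k)) <
          (lienardDamping α β (Y z) - 2 * z) / Y z := by
        rw [sub_div, sub_div]
        linarith
      have h7 := div_lt_div_of_pos_right h6 hα
      rw [div_div, div_div, mul_comm _ α, mul_comm _ α] at h7
      exact sub_pos.2 h7
  have h1 := hmono (left_mem_Icc.2 hz₀a.le) (right_mem_Icc.2 hz₀a.le) hz₀a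
  simp only [hY.right, mul_div_cancel_left₀ a hk0.ne', hX.right] at h1
  have h2 := hle' z₀ (hmem z₀ (left_mem_Icc.2 hz₀a.le))
  linarith

/-- If `k c ≤ c'`, then `Y` lies below the dilated profile `Z` and both vanish at `-k c`. Just to
the right, `Y < Z < b` gives `k F(Z/k) < F(Z) < F(Y)`, so `Z² - Y²` decreases from zero,
contradicting `Y < Z`. -/
theorem lt_mul_right (hα : 0 < α) (hβ : 0 < β) {b : ℝ} (hb : 0 < b)
    (hbanti : StrictAntiOn (lienardDamping α β) (Icc 0 b)) (hk : 1 < k) (ha : 0 < a) (hc : 0 < c)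
    (hX : IsLienardProfile α β a c X) (hY : IsLienardProfile α β (k * a) c' Y) : c' < k * c := by
  by_contra! hcc'
  have hk0 : 0 < k := by linarith
  have hka := mul_pos hk0 ha
  have hkc := mul_pos hk0 hc
  have hlt : ∀ y ∈ Ioo (-(k * c)) (k * a), Y y < k * X (y / k) := fun y hy =>
    lt_dilation hα hβ hk ha hc hX hY hcc' hy
  have hcX := hX.continuousOn_dilation hk0
  have hcY : ContinuousOn Y (Icc (-(k * c)) (k * a)) :=
    hY.continuousOn.mono (Icc_subset_Icc (by linarith) le_rfl)
  have hXleft : k * X (-(k * c) / k) = 0 := by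
    rw [neg_div, mul_div_cancel_left₀ _ hk0.ne', hX.left, mul_zero]
  have hlt0 : -(k * c) < k * a := by linarith
  have hnhds : Ioo (-(k * c)) (k * a) ∈ 𝓝[>] (-(k * c)) := Ioo_mem_nhdsGT hlt0
  have hXlim : Tendsto (fun y => k * X (y / k)) (𝓝[>] (-(k * c))) (𝓝 0) := by
    have h1 := (hcX _ (left_mem_Icc.2 hlt0.le)).mono_of_mem_nhdsWithin
      (s := Ioi (-(k * c))) (mem_of_superset hnhds Ioo_subset_Icc_self)
    simpa only [ContinuousWithinAt, hXleft] using h1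
  have hYlim : Tendsto Y (𝓝[>] (-(k * c))) (𝓝 (Y (-(k * c)))) :=
    (hcY _ (left_mem_Icc.2 hlt0.le)).mono_of_mem_nhdsWithin
      (s := Ioi (-(k * c))) (mem_of_superset hnhds Ioo_subset_Icc_self)
  have hYle : Y (-(k * c)) ≤ 0 := by
    refine le_of_tendsto_of_tendsto hYlim hXlim ?_
    filter_upwards [hnhds] with y hy
    exact (hlt y hy).le
  have hYleft : Y (-(k * c)) = 0 := by
    rcases hcc'.eq_or_lt with h | h
    · rw [h, hY.left]
    · exact absurd (hY.pos _ ⟨by linarith, hlt0⟩) (not_lt.2 hYle)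
  obtain ⟨d, hd, hdsub⟩ := (mem_nhdsGT_iff_exists_Ioo_subset' hlt0).1
    (inter_mem hnhds (hXlim.eventually (gt_mem_nhds hb)))
  have hd' : -(k * c) < d := hd
  set e := (-(k * c) + d) / 2 with he
  have he1 : -(k * c) < e := by rw [he]; linarith
  have he2 : e < d := by rw [he]; linarith
  have hsub : ∀ y, -(k * c) < y → y ≤ e →
      y ∈ Ioo (-(k * c)) (k * a) ∧ k * X (y / k) < b := fun y h1 h2 =>
    hdsub ⟨h1, by linarith⟩
  -- Squaring removes the singular denominator and cancels the terms in `y`.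
  have hanti : StrictAntiOn (fun y => (k * X (y / k)) ^ 2 - Y y ^ 2) (Icc (-(k * c)) e) := by
    have hsubset : Icc (-(k * c)) e ⊆ Icc (-(k * c)) (k * a) :=
      Icc_subset_Icc le_rfl (hsub e he1 le_rfl).1.2.le
    refine strictAntiOn_of_hasDerivWithinAt_neg (convex_Icc _ _)
      (f' := fun y => 2 / α * (k * lienardDamping α β (X (y / k)) - lienardDamping α β (Y y)))
      (((hcX.mono hsubset).pow 2).sub ((hcY.mono hsubset).pow 2)) (fun y hy => ?_) fun y hy => ?_
    all_goals
      rw [interior_Icc] at hy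
      obtain ⟨hy1, hy2⟩ := hsub y hy.1 hy.2.le
      have hXpos := hX.pos_dilation hk0 hy1
      have hYmem : y ∈ Ioo (-c') (k * a) := ⟨by linarith [hy1.1], hy1.2⟩
      have hYpos := hY.pos y hYmem
    · refine HasDerivAt.hasDerivWithinAt ((((hX.hasDerivAt_dilation hk0 hy1).fun_pow 2).fun_sub
        ((hY.hasDerivAt y hYmem).fun_pow 2)).congr_deriv ?_)
      have hX0 : X (y / k) ≠ 0 := fun h => by simp [h] at hXpos
      field_simp
      ring
    · have h1 := mul_lienardDamping_div_lt (α := α) hβ hXpos hk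
      rw [mul_div_cancel_left₀ _ hk0.ne'] at h1
      have h2 := hlt y hy1
      have h3 := hbanti ⟨hYpos.le, by linarith⟩ ⟨hXpos.le, hy2.le⟩ h2
      exact mul_neg_of_pos_of_neg (by positivity) (by linarith)
  have h1 := hanti (left_mem_Icc.2 he1.le) (right_mem_Icc.2 he1.le) he1
  simp only [hXleft, hYleft] at h1
  have h2 := (hsub e he1 le_rfl).1
  have h3 := hlt e h2
  have h4 := hY.pos e ⟨by linarith [h2.1], h2.2⟩
  nlinarith

end IsLienardProfile

/-! ### Dynamics of sublinear increasing maps. -/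

section IntervalMap

/-- A strictly increasing map `P` of the positive half line for which `P x / x` is strictly
decreasing, above the diagonal near `0` and below it somewhere, has a globally attracting fixed
point. -/
theorem exists_tendsto_iterate {P : ℝ → ℝ} (hpos : ∀ x, 0 < x → 0 < P x)
    (hmono : ∀ x y, 0 < x → x < y → P x < P y)
    (hratio : ∀ x k, 0 < x → 1 < k → P (k * x) < k * P x) {s t : ℝ} (hs : 0 < s) (hst : s ≤ t)
    (hPs : s ≤ P s) (hPt : P t ≤ t) :
    ∃ r, 0 < r ∧ P r = r ∧ ∀ x, 0 < x → Tendsto (fun n => P^[n] x) atTop (𝓝 r) := by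
  have hle : ∀ x y, 0 < x → x ≤ y → P x ≤ P y := fun x y hx hxy => by
    rcases hxy.eq_or_lt with rfl | h
    · exact le_rfl
    · exact (hmono x y hx h).le
  have hratio' : ∀ x y, 0 < x → x < y → P y < y / x * P x := fun x y hx hxy => by
    have := hratio x (y / x) hx ((one_lt_div hx).2 hxy)
    rwa [div_mul_cancel₀ _ hx.ne'] at this
  -- Monotonicity and sublinearity trap `P y` between `min 1 (y/x) * P x` and `max 1 (y/x) * P x`.
  have hcont : ∀ x, 0 < x → ContinuousAt P x := fun x hx => by
    have hlow : Tendsto (fun y => min 1 (y / x) * P x) (𝓝 x) (𝓝 (P x)) := by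
      have : ContinuousAt (fun y => min 1 (y / x) * P x) x := by fun_prop
      simpa [ContinuousAt, div_self hx.ne'] using this
    have hup : Tendsto (fun y => max 1 (y / x) * P x) (𝓝 x) (𝓝 (P x)) := by
      have : ContinuousAt (fun y => max 1 (y / x) * P x) x := by fun_prop
      simpa [ContinuousAt, div_self hx.ne'] using this
    refine tendsto_of_tendsto_of_tendsto_of_le_of_le' hlow hup ?_ ?_
    all_goals
      filter_upwards [lt_mem_nhds hx] with y hy
      have hPx := hpos x hx
    · rcases lt_or_ge y x with h | h
      · have h1 := hratio' y x hy h
        refine (mul_le_mul_of_nonneg_right (min_le_right _ _) hPx.le).trans ?_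
        rw [div_mul_eq_mul_div, lt_div_iff₀ hy] at h1
        rw [div_mul_eq_mul_div, div_le_iff₀ hx]
        linarith
      · refine (mul_le_mul_of_nonneg_right (min_le_left _ _) hPx.le).trans ?_
        rw [one_mul]
        exact hle x y hx h
    · rcases le_or_gt y x with h | h
      · refine le_trans ?_ (mul_le_mul_of_nonneg_right (le_max_left _ _) hPx.le)
        rw [one_mul]
        exact hle y x hy h
      · exact (hratio' x y hx h).le.trans
          (mul_le_mul_of_nonneg_right (le_max_right _ _) hPx.le)
  obtain ⟨r, hr, hr0⟩ := intermediate_value_Icc' hst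
    (f := fun x => P x - x) (fun x hx => ((hcont x (hs.trans_le hx.1)).sub
      continuousAt_id).continuousWithinAt) (show (0 : ℝ) ∈ _ from ⟨by linarith, by linarith⟩)
  have hrpos : 0 < r := hs.trans_le hr.1
  have hPr : P r = r := by
    simp only at hr0
    linarith
  have hbelow : ∀ x, 0 < x → x < r → x < P x := fun x hx hxr => by
    have := hratio' x r hx hxr
    rw [hPr, div_mul_eq_mul_div, lt_div_iff₀ hx] at this
    exact lt_of_mul_lt_mul_left this hrpos.le
  have habove : ∀ x, r < x → P x < x := fun x hrx => by
    have := hratio' r x hrpos hrx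
    rwa [hPr, div_mul_cancel₀ _ hrpos.ne'] at this
  refine ⟨r, hrpos, hPr, fun x hx => ?_⟩
  rcases le_or_gt x r with hxr | hxr
  · have hmem : ∀ n, P^[n] x ∈ Icc x r := fun n => by
      induction n with
      | zero => exact ⟨le_rfl, hxr⟩
      | succ n ih =>
        rw [Function.iterate_succ_apply']
        have h0 := hx.trans_le ih.1
        refine ⟨?_, hPr ▸ hle _ _ h0 ih.2⟩
        rcases ih.2.eq_or_lt with h | h
        · rw [h, hPr]
          exact hxr
        · exact ih.1.trans (hbelow _ h0 h).le
    have hstep : Monotone fun n => P^[n] x := monotone_nat_of_le_succ fun n => by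
      rw [Function.iterate_succ_apply']
      rcases (hmem n).2.eq_or_lt with h | h
      · rw [h, hPr]
      · exact (hbelow _ (hx.trans_le (hmem n).1) h).le
    have hlim := tendsto_atTop_ciSup hstep ⟨r, by rintro _ ⟨n, rfl⟩; exact (hmem n).2⟩
    set l := ⨆ n, P^[n] x
    have hl : l ∈ Icc x r := isClosed_Icc.mem_of_tendsto hlim (Eventually.of_forall hmem)
    have hfix := isFixedPt_of_tendsto_iterate hlim (hcont l (hx.trans_le hl.1))
    rcases hl.2.eq_or_lt with h | h
    · rwa [h] at hlim
    · exact absurd hfix.eq (hbelow l (hx.trans_le hl.1) h).ne'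
  · have hmem : ∀ n, P^[n] x ∈ Icc r x := fun n => by
      induction n with
      | zero => exact ⟨hxr.le, le_rfl⟩
      | succ n ih =>
        rw [Function.iterate_succ_apply']
        refine ⟨hPr ▸ hle _ _ hrpos ih.1, ?_⟩
        rcases ih.1.eq_or_lt with h | h
        · rw [← h, hPr]
          exact hxr.le
        · exact (habove _ h).le.trans ih.2
    have hstep : Antitone fun n => P^[n] x := antitone_nat_of_succ_le fun n => by
      rw [Function.iterate_succ_apply']
      rcases (hmem n).1.eq_or_lt with h | h
      · rw [← h, hPr]
      · exact (habove _ h).le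
    have hlim := tendsto_atTop_ciInf hstep ⟨r, by rintro _ ⟨n, rfl⟩; exact (hmem n).1⟩
    set l := ⨅ n, P^[n] x
    have hl : l ∈ Icc r x := isClosed_Icc.mem_of_tendsto hlim (Eventually.of_forall hmem)
    have hfix := isFixedPt_of_tendsto_iterate hlim (hcont l (hrpos.trans_le hl.1))
    rcases hl.1.eq_or_lt with h | h
    · rwa [← h] at hlim
    · exact absurd hfix.eq (habove l h).ne

end IntervalMap

/-! ### The limit cycle and its attraction. -/

section LimitCycle

variable {α β : ℝ}

/-- The half return map of the axis `lam = 0`, with its return time, and its attracting fixed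
point. -/
theorem exists_halfReturn (hα : 0 < α) (h : α / 2 + 1 < β) :
    ∃ P τ : ℝ → ℝ, (∀ a, 0 < a → IsHalfArc α β a (τ a) (P a)) ∧
      ∃ r, 0 < r ∧ P r = r ∧ ∀ a, 0 < a → Tendsto (fun n => P^[n] a) atTop (𝓝 r) := by
  have hβ : 0 < β := by linarith
  have harc : ∀ a, ∃ τ c, 0 < a → IsHalfArc α β a τ c := fun a => by
    by_cases ha : 0 < a
    · obtain ⟨τ, c, hc⟩ := exists_isHalfArc hα h ha
      exact ⟨τ, c, fun _ => hc⟩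
    · exact ⟨0, 0, fun h => absurd h ha⟩
  choose τ P hP using harc
  obtain ⟨b, hb, hbanti⟩ := exists_strictAntiOn_lienardDamping h
  have hFb : lienardDamping α β b < 0 := by
    have := hbanti ⟨le_rfl, hb.le⟩ ⟨hb.le, le_rfl⟩ hb
    rwa [lienardDamping_zero] at this
  -- This makes `2 s < -F(b)`, so `P s > s`; the upper endpoint is `β`, where `P β < β`.
  set s := min β (-lienardDamping α β b / 3) with hs
  have hs0 : 0 < s := lt_min hβ (by linarith)
  have hs1 : s ≤ -lienardDamping α β b / 3 := min_le_right _ _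
  refine ⟨P, τ, hP, exists_tendsto_iterate (fun a ha => (hP a ha).right_pos)
    (fun a a' ha haa' => (hP a ha).right_lt_right hα hβ (hP a' (ha.trans haa')) haa')
    (fun a k ha hk => ?_) hs0 (min_le_left _ _)
    ((hP s hs0).left_lt_right hα hβ hb hbanti (by linarith)).le ((hP β hβ).right_lt hβ).le⟩
  obtain ⟨X, hX, -⟩ := (hP a ha).exists_profile hα hβ
  obtain ⟨Y, hY, -⟩ := (hP (k * a) (mul_pos (by linarith) ha)).exists_profile hα hβ
  exact hX.lt_mul_right hα hβ hb hbanti hk ha (hP a ha).right_pos hY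

variable {P τ : ℝ → ℝ} {r : ℝ}

/-- The arc ends at the negative of its start, and the flow is odd. -/
theorem spinFlow_add_halfPeriod (hP : IsHalfArc α β r (τ r) r) (t : ℝ) :
    spinFlow α β (0, r / β) (t + τ r) = -spinFlow α β (0, r / β) t := by
  rw [← spinFlow_add, hP.map_time, ← spinFlow_neg]
  congr 1
  ext <;> simp [neg_div]

theorem periodic_spinFlow (hP : IsHalfArc α β r (τ r) r) :
    Function.Periodic (spinFlow α β (0, r / β)) (2 * τ r) := fun t => by
  rw [two_mul, ← add_assoc, spinFlow_add_halfPeriod hP, spinFlow_add_halfPeriod hP, neg_neg]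

theorem infDist_neg_range_spinFlow_le (hP : IsHalfArc α β r (τ r) r) (q : ℝ × ℝ) :
    Metric.infDist (-q) (range (spinFlow α β (0, r / β))) ≤
      Metric.infDist q (range (spinFlow α β (0, r / β))) := by
  refine (Metric.le_infDist (range_nonempty _)).2 ?_
  rintro _ ⟨t, rfl⟩
  rw [← dist_neg_neg, ← spinFlow_add_halfPeriod hP]
  exact Metric.infDist_le_dist_of_mem (mem_range_self _)

/-- The times at which the orbit of `(0, a / β)` crosses the axis `lam = 0`. -/
noncomputable def crossingTime (P τ : ℝ → ℝ) (a : ℝ) (n : ℕ) : ℝ :=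
  ∑ i ∈ Finset.range n, τ (P^[i] a)

theorem crossingTime_succ (P τ : ℝ → ℝ) (a : ℝ) (n : ℕ) :
    crossingTime P τ a (n + 1) = crossingTime P τ a n + τ (P^[n] a) :=
  Finset.sum_range_succ _ _

theorem iterate_pos (hP : ∀ a, 0 < a → IsHalfArc α β a (τ a) (P a)) {a : ℝ} (ha : 0 < a) (n : ℕ) :
    0 < P^[n] a := by
  induction n with
  | zero => exact ha
  | succ n ih =>
    rw [Function.iterate_succ_apply']
    exact (hP _ ih).right_pos

theorem spinFlow_crossingTime_add (hP : ∀ a, 0 < a → IsHalfArc α β a (τ a) (P a)) {a : ℝ}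
    (ha : 0 < a) (n : ℕ) (t : ℝ) :
    spinFlow α β (0, a / β) (t + crossingTime P τ a n) =
      (-1 : ℝ) ^ n • spinFlow α β (0, P^[n] a / β) t := by
  induction n generalizing t with
  | zero => simp [crossingTime]
  | succ n ih =>
    rw [crossingTime_succ, add_comm (crossingTime P τ a n), ← add_assoc, ih, ← spinFlow_add,
      (hP _ (iterate_pos hP ha n)).map_time, pow_succ, mul_smul, neg_one_smul,
      ← spinFlow_neg, Function.iterate_succ_apply']
    congr 2
    ext <;> simp [neg_div]

theorem strictMono_crossingTime (hP : ∀ a, 0 < a → IsHalfArc α β a (τ a) (P a)) {a : ℝ}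
    (ha : 0 < a) : StrictMono (crossingTime P τ a) := strictMono_nat_of_lt_succ fun n => by
  rw [crossingTime_succ]
  linarith [(hP _ (iterate_pos hP ha n)).time_pos]

/-- At a finite accumulation time `T`, products of consecutive crossing values of `m` would tend
both to `m(T)² ≥ 0` and to `-(r / β)² < 0`. -/
theorem tendsto_crossingTime (hβ : 0 < β) (hP : ∀ a, 0 < a → IsHalfArc α β a (τ a) (P a)) {a : ℝ}
    (ha : 0 < a) (hr : 0 < r) (hlim : Tendsto (fun n => P^[n] a) atTop (𝓝 r)) :
    Tendsto (crossingTime P τ a) atTop atTop := by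
  refine (tendsto_atTop_of_monotone (strictMono_crossingTime hP ha).monotone).resolve_right ?_
  rintro ⟨T, hT⟩
  have h1 : Tendsto (fun n => (spinFlow α β (0, a / β) (crossingTime P τ a n)).2) atTop
      (𝓝 (spinFlow α β (0, a / β) T).2) :=
    ((continuous_spinFlow _).snd.tendsto T).comp hT
  have h2 : ∀ n, (spinFlow α β (0, a / β) (crossingTime P τ a n)).2 =
      (-1 : ℝ) ^ n * (P^[n] a / β) := fun n => by
    have := spinFlow_crossingTime_add hP ha n 0
    rw [zero_add, spinFlow_zero] at this
    rw [this]
    simp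
  simp only [h2] at h1
  have h3 := h1.mul (h1.comp (tendsto_add_atTop_nat 1))
  have h4 : Tendsto (fun n => -(P^[n] a / β * (P^[n + 1] a / β))) atTop
      (𝓝 (-(r / β * (r / β)))) :=
    ((hlim.div_const β).mul ((hlim.comp (tendsto_add_atTop_nat 1)).div_const β)).neg
  have h5 : (fun n => (-1 : ℝ) ^ n * (P^[n] a / β) *
      ((fun n => (-1 : ℝ) ^ n * (P^[n] a / β)) ∘ fun n => n + 1) n) =
      fun n => -(P^[n] a / β * (P^[n + 1] a / β)) := by
    funext n
    simp only [Function.comp_apply, pow_succ]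
    have : (-1 : ℝ) ^ n * (-1) ^ n = 1 := by rw [← mul_pow]; norm_num
    linear_combination (-(P^[n] a / β * (P^[n + 1] a / β))) * this
  rw [h5] at h3
  have h6 := tendsto_nhds_unique h3 h4
  have h7 : 0 < r / β * (r / β) := by positivity
  nlinarith [mul_self_nonneg (spinFlow α β (0, a / β) T).2]

/-- At time `3 τ(r) / 2` the cycle has `lam < 0`, hence so do nearby orbits; their first half arc
has already ended. -/
theorem eventually_returnTime_lt (hP : ∀ a, 0 < a → IsHalfArc α β a (τ a) (P a)) (hr : 0 < r)
    (hPr : P r = r) : ∀ᶠ a in 𝓝 r, τ a < 2 * τ r := by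
  have hPr' := hP r hr
  have hτ := hPr'.time_pos
  rw [hPr] at hPr'
  have hneg : (spinFlow α β (0, r / β) (τ r / 2 + τ r)).1 < 0 := by
    rw [spinFlow_add_halfPeriod hPr', Prod.fst_neg, neg_lt_zero]
    exact hPr'.fst_pos _ ⟨by linarith, by linarith⟩
  have hcont : Continuous fun a : ℝ => (spinFlow α β (0, a / β) (τ r / 2 + τ r)).1 :=
    ((continuous_spinFlow_left (by linarith)).comp
      (continuous_const.prodMk (continuous_id.div_const β))).fst
  filter_upwards [hcont.continuousAt.eventually_lt_const hneg, lt_mem_nhds hr] with a ha ha0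
  by_contra! hle
  exact absurd ((hP a ha0).fst_nonneg ⟨by linarith, by linarith⟩) (not_le.2 ha)

/-- Between late crossings the orbit is, up to sign, that of `(0, P^[n] a / β)` for a time below `2
τ(r)`. Grönwall compares it with the cycle, which is symmetric. -/
theorem tendsto_infDist_of_axis (hβ : 0 < β) (hP : ∀ a, 0 < a → IsHalfArc α β a (τ a) (P a))
    (hr : 0 < r) (hPr : P r = r) {a : ℝ} (ha : 0 < a)
    (hlim : Tendsto (fun n => P^[n] a) atTop (𝓝 r)) :
    Tendsto (fun t => Metric.infDist (spinFlow α β (0, a / β) t)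
      (range (spinFlow α β (0, r / β)))) atTop (𝓝 0) := by
  set Γ := range (spinFlow α β (0, r / β)) with hΓ
  have hPr' := hP r hr
  rw [hPr] at hPr'
  obtain ⟨K, hK⟩ := exists_dist_spinFlow_le α β
  refine tendsto_order.2 ⟨fun ε hε => Eventually.of_forall fun t =>
    hε.trans_le Metric.infDist_nonneg, fun ε hε => ?_⟩
  have hdist : Tendsto (fun n => dist ((0 : ℝ), P^[n] a / β) (0, r / β) *
      Real.exp (K * (2 * τ r))) atTop (𝓝 0) := by
    have h1 : Tendsto (fun n => ((0 : ℝ), P^[n] a / β)) atTop (𝓝 (0, r / β)) :=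
      tendsto_const_nhds.prodMk_nhds (hlim.div_const β)
    simpa using (tendsto_iff_dist_tendsto_zero.1 h1).mul_const (Real.exp (K * (2 * τ r)))
  obtain ⟨N, hN⟩ := ((hdist.eventually (gt_mem_nhds hε)).and
    (hlim.eventually (eventually_returnTime_lt hP hr hPr))).exists_forall_of_atTop
  have hT := tendsto_crossingTime hβ hP ha hr hlim
  filter_upwards [eventually_ge_atTop (crossingTime P τ a N)] with t ht
  obtain ⟨m, hm⟩ := (hT.eventually (eventually_gt_atTop t)).exists
  obtain ⟨n, hNn, hn1, hn2⟩ : ∃ n, N ≤ n ∧ crossingTime P τ a n ≤ t ∧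
      t < crossingTime P τ a (n + 1) := by
    classical
    have hex : ∃ m, t < crossingTime P τ a m := ⟨m, hm⟩
    have hspec := Nat.find_spec hex
    have hNlt : N < Nat.find hex :=
      (strictMono_crossingTime hP ha).lt_iff_lt.1 (ht.trans_lt hspec)
    refine ⟨Nat.find hex - 1, by omega, not_lt.1 (Nat.find_min hex (by omega)), ?_⟩
    rwa [Nat.sub_add_cancel (by omega)]
  obtain ⟨hn3, hn4⟩ := hN n hNn
  rw [crossingTime_succ] at hn2
  set s := t - crossingTime P τ a n with hs
  have hs0 : 0 ≤ s := by linarith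
  have hs1 : s ≤ 2 * τ r := by linarith
  have hts : t = s + crossingTime P τ a n := by linarith
  have hsmul : Metric.infDist (spinFlow α β (0, a / β) t) Γ ≤
      Metric.infDist (spinFlow α β (0, P^[n] a / β) s) Γ := by
    rw [hts, spinFlow_crossingTime_add hP ha]
    rcases neg_one_pow_eq_or ℝ n with h | h <;> rw [h]
    · rw [one_smul]
    · rw [neg_one_smul]
      exact infDist_neg_range_spinFlow_le hPr' _
  calc _ ≤ Metric.infDist (spinFlow α β (0, P^[n] a / β) s) Γ := hsmul
    _ ≤ dist (spinFlow α β (0, P^[n] a / β) s) (spinFlow α β (0, r / β) s) :=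
      Metric.infDist_le_dist_of_mem (mem_range_self _)
    _ ≤ dist ((0 : ℝ), P^[n] a / β) (0, r / β) * Real.exp (K * s) := hK _ _ s hs0
    _ ≤ dist ((0 : ℝ), P^[n] a / β) (0, r / β) * Real.exp (K * (2 * τ r)) := by gcongr
    _ < ε := hn3

theorem tendsto_infDist_of_ne_zero (hα : 0 < α) (h : α / 2 + 1 < β)
    (hP : ∀ a, 0 < a → IsHalfArc α β a (τ a) (P a)) (hr : 0 < r) (hPr : P r = r)
    (hlim : ∀ a, 0 < a → Tendsto (fun n => P^[n] a) atTop (𝓝 r)) {p : ℝ × ℝ} (hp : p ≠ 0) :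
    Tendsto (fun t => Metric.infDist (spinFlow α β p t) (range (spinFlow α β (0, r / β)))) atTop
      (𝓝 0) := by
  have hβ : 0 < β := by linarith
  obtain ⟨s, hs, hs0⟩ := exists_spinFlow_fst_eq_zero hα h p
  wlog hpos : 0 ≤ (spinFlow α β p s).2 generalizing p
  · have h1 := this (neg_ne_zero.2 hp) (by simp [spinFlow_neg, hs0]) (by
      rw [spinFlow_neg, Prod.snd_neg]
      linarith)
    refine squeeze_zero (fun _ => Metric.infDist_nonneg) (fun t => ?_) h1
    have hPr' := hP r hr
    rw [hPr] at hPr'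
    have h2 := infDist_neg_range_spinFlow_le hPr' (spinFlow α β (-p) t)
    rwa [← spinFlow_neg, neg_neg] at h2
  have hne : (spinFlow α β p s).2 ≠ 0 := fun h0 => spinFlow_ne_zero hp s (Prod.ext hs0 h0)
  have ha : 0 < β * (spinFlow α β p s).2 := mul_pos hβ (lt_of_le_of_ne hpos hne.symm)
  have h1 := tendsto_infDist_of_axis hβ hP hr hPr ha (hlim _ ha)
  have h2 : (0, β * (spinFlow α β p s).2 / β) = spinFlow α β p s := by
    rw [mul_div_cancel_left₀ _ hβ.ne']
    exact Prod.ext hs0.symm rfl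
  rw [h2] at h1
  simp only [spinFlow_add] at h1
  refine (h1.comp (tendsto_atTop_add_const_right _ (-s) tendsto_id)).congr fun t => ?_
  simp

theorem isPeriodicOrbit_range_spinFlow (hP : IsHalfArc α β r (τ r) r) (hβ : 0 < β) :
    IsPeriodicOrbit (spinField α β) (range (spinFlow α β (0, r / β))) := by
  refine ⟨_, isIntegralCurve_spinFlow _,
    ⟨2 * τ r, by linarith [hP.time_pos], periodic_spinFlow hP⟩, ⟨τ r, ?_⟩, rfl⟩
  rw [hP.map_time, spinFlow_zero, Ne, Prod.mk.injEq, div_left_inj' hβ.ne']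
  intro h
  linarith [h.2, hP.left_pos]

/-- A periodic orbit attracting all nonzero points is the only periodic orbit. -/
theorem IsPeriodicOrbit.eq_range_spinFlow {q : ℝ × ℝ} {T : ℝ} (hT : 0 < T)
    (hq : Function.Periodic (spinFlow α β q) T)
    (hattr : ∀ p ≠ 0, Tendsto (fun t => Metric.infDist (spinFlow α β p t)
      (range (spinFlow α β q))) atTop (𝓝 0)) {Γ : Set (ℝ × ℝ)}
    (hΓ : IsPeriodicOrbit (spinField α β) Γ) : Γ = range (spinFlow α β q) := by
  obtain ⟨x, hx, ⟨S, hS, hxS⟩, ⟨t, ht⟩, rfl⟩ := hΓ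
  have hx' := eq_spinFlow_of_isIntegralCurve hx
  have hx0 : x 0 ≠ 0 := fun h0 => by
    rw [hx', h0, spinFlow_of_zero, spinFlow_of_zero] at ht
    exact ht rfl
  have hlim := hattr _ hx0
  rw [← hx'] at hlim
  have hclosed : IsClosed (range (spinFlow α β q)) :=
    (hq.compact_of_continuous hT.ne' (continuous_spinFlow q)).isClosed
  -- Along multiples of the period `S` the distance to the closed cycle is constant, yet it tends to
  -- zero.
  have hmem : x 0 ∈ range (spinFlow α β q) := by
    rw [hclosed.mem_iff_infDist_zero (range_nonempty _)]
    have hseq : Tendsto (fun n : ℕ => (n : ℝ) * S) atTop atTop :=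
      tendsto_natCast_atTop_atTop.atTop_mul_const hS
    refine tendsto_nhds_unique (tendsto_const_nhds (f := (atTop : Filter ℕ)))
      ((hlim.comp hseq).congr fun n => ?_)
    have := hxS.nat_mul_eq n
    rw [Function.comp_apply, this]
  obtain ⟨s, hs⟩ := hmem
  have hshift : ∀ t, x t = spinFlow α β q (t + s) := fun t => by
    rw [hx', ← hs, spinFlow_add]
  ext z
  constructor
  · rintro ⟨t, rfl⟩
    exact ⟨t + s, (hshift t).symm⟩
  · rintro ⟨t, rfl⟩
    exact ⟨t - s, by rw [hshift, sub_add_cancel]⟩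

end LimitCycle

theorem theorem2 (α β : ℝ) (hα : 0 < α) (hβ : 0 ≤ β) :
    (β ≤ α / 2 + 1 → IsGlobalAttractor (spinField α β) 0) ∧
    (α / 2 + 1 < β →
      ∃ Γ : Set (ℝ × ℝ), IsPeriodicOrbit (spinField α β) Γ ∧
        (∀ Γ' : Set (ℝ × ℝ), IsPeriodicOrbit (spinField α β) Γ' → Γ' = Γ) ∧
        ∀ p : ℝ × ℝ, p ≠ 0 → AttractsFrom (spinField α β) Γ p) := by
  refine ⟨isGlobalAttractor_zero hα hβ, fun h => ?_⟩
  obtain ⟨P, τ, hP, r, hr, hPr, hlim⟩ := exists_halfReturn hα h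
  have hPr' := hP r hr
  rw [hPr] at hPr'
  have hattr := fun (p : ℝ × ℝ) (hp : p ≠ 0) =>
    tendsto_infDist_of_ne_zero hα h hP hr hPr hlim hp
  exact ⟨_, isPeriodicOrbit_range_spinFlow hPr' (by linarith),
    fun Γ' hΓ' => hΓ'.eq_range_spinFlow (by linarith [hPr'.time_pos]) (periodic_spinFlow hPr') hattr,
    fun p hp => attractsFrom_of_tendsto (hattr p hp)⟩
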